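/- Let $d\ge 1$, let $\mathcal X\subset\mathbb R^d$ be a closed convex set with $\|\mathbf x-\mathbf y\|_\infty\le D_\infty$ for all $\mathbf x,\mathbf y\in\mathcal X$, and let $f(\cdot;\xi):\mathbb R^d\to\mathbb R$ be convex for every $\xi$. Let $\xi_1,\xi_2,\dots$ be random samples such that $\mathbb E|f(\mathbf x;\xi_t)|<\infty$ for all $t$ and all $\mathbf x\in\mathbb R^d$, write $f_t=f(\cdot;\xi_t)$, and let $\mathbf u_1,\mathbf u_2,\dots$ be i.i.d. random vectors, uniform on the unit Euclidean sphere and independent of the samples. Let $\mu>0$, $\alpha>0$, $\beta_1,\beta_2\in[0,1)$ with $\gamma:=\beta_1/\sqrt{\beta_2}<1$ (so $\beta_2>0$, except that $\beta_1=\beta_2=0$ is allowed, with $\gamma:=0$), $\alpha_t=\alpha/\sqrt t$ and $\beta_{1,t}=\beta_1/t$. ZO-AdaMM starts from $\mathbf x_1\in\mathcal X$, $\mathbf m_0=\mathbf v_0=\mathbf 0$ and some $\hat{\mathbf v}_0\ge\mathbf 0$, and computes for $t=1,2,\dots$ (squares, maxima and square roots being coordinatewise) $$\hat{\mathbf g}_t=\tfrac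 d\mu\,[f_t(\mathbf x_t+\mu\mathbf u_t)-f_t(\mathbf x_t)]\,\mathbf u_t,\quad \mathbf m_t=\beta_{1,t}\mathbf m_{t-1}+(1-\beta_{1,t})\hat{\mathbf g}_t,\quad \mathbf v_t=\beta_2\mathbf v_{t-1}+(1-\beta_2)\hat{\mathbf g}_t^2,$$ $$\hat{\mathbf v}_t=\max(\hat{\mathbf v}_{t-1},\mathbf v_t),\quad \hat{\mathbf V}_t=\mathrm{diag}(\hat{\mathbf v}_t),\quad \mathbf x_{t+1}\in\operatorname*{arg\,min}_{\mathbf x\in\mathcal X}\big\|\hat{\mathbf V}_t^{1/4}\big(\mathbf x-(\mathbf x_t-\alpha_t\hat{\mathbf V}_t^{-1/2}\mathbf m_t)\big)\big\|_2^2 .$$ (If $\hat v_{t,i}=0$, then $m_{t,i}=0$ and $m_{t,i}/\hat v_{t,i}^{1/2}$ is read as $0$; if the minimizer is not unique, any one may be taken, chosen measurably from the samples and directions of rounds $1,\dots,t$.) Let $f_{t,\mu}(\mathbf x)=\mathbb E_{\mathbf w}[f_t(\mathbf x+\mu\mathbf w)]$ with $\mathbf w$ uniform on the closed unit Euclidean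 ball, and $\hat{\mathbf g}_{1:T,i}=[\hat g_{1,i},\dots,\hat g_{T,i}]^\top$. Then for every $T\ge 1$ and every $\mathbf x^*\in\mathcal X$ (in particular for an optimal solution; $\mathbf x^*$ may even be a measurable function of the samples $\xi_t$), all the expectations below are finite and $$\mathbb E\Big[\frac1T\sum_{t=1}^Tf_{t,\mu}(\mathbf x_t)-\frac1T\sum_{t=1}^Tf_{t,\mu}(\mathbf x^*)\Big]\le\frac{D_\infty^2\sum_{i=1}^d\mathbb E[\hat v_{T,i}^{1/2}]}{\alpha(1-\beta_1)\sqrt T}+\frac{D_\infty^2}{2(1-\beta_1)T}\sum_{t=1}^T\sum_{i=1}^d\frac{\beta_1\mathbb E[\hat v_{t,i}^{1/2}]}{\alpha\sqrt t}+\frac{\alpha\sqrt{1+\log T}\,\sum_{i=1}^d\mathbb E\|\hat{\mathbf g}_{1:T,i}\|_2}{(1-\beta_1)^2(1-\gamma)\sqrt{1-\beta_2}\;T}.$$ -/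

import Mathlib

open MeasureTheory ProbabilityTheory

noncomputable section

namespace ZOAdaMM

/-- The space `ℝ^d` with its Euclidean norm. -/
abbrev Vec (d : ℕ) : Type := EuclideanSpace ℝ (Fin d)

/-- The uniform probability distribution on the unit sphere of `ℝ^d` (`1 ≤ d`): the normalized
surface measure, seen as a measure on `ℝ^d`. -/
def sphereUniform (d : ℕ) : Measure (Vec d) :=
  ((volume : Measure (Vec d)).toSphere Set.univ)⁻¹ •
    Measure.map (Subtype.val : Metric.sphere (0 : Vec d) 1 → Vec d)
      (volume : Measure (Vec d)).toSphere

/-- The smoothing function `h_μ(x) = E[h(x + μ w)]`, `w` uniform on the unit Euclidean ball. -/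
def smoothing {d : ℕ} (μ : ℝ) (h : Vec d → ℝ) (x : Vec d) : ℝ :=
  ⨍ w in Metric.closedBall (0 : Vec d) 1, h (x + μ • w)

/-- The zeroth-order gradient estimate `(d / μ) [h(x + μ u) - h(x)] u` along the direction `u`. -/
def zoGrad {d : ℕ} (μ : ℝ) (h : Vec d → ℝ) (u x : Vec d) : Vec d :=
  ((d : ℝ) / μ * (h (x + μ • u) - h x)) • u

/-- `m_0 = 0`, `m_t = β_{1,t} m_{t-1} + (1 - β_{1,t}) g_t` for `t ≥ 1`. -/
def momentum {d : ℕ} (β₁ : ℕ → ℝ) (g : ℕ → Vec d) : ℕ → Vec d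
  | 0 => 0
  | t + 1 => β₁ (t + 1) • momentum β₁ g t + (1 - β₁ (t + 1)) • g (t + 1)

/-- `v_0 = 0`, `v_t = β_2 v_{t-1} + (1 - β_2) g_t^2` for `t ≥ 1`, coordinate by coordinate. -/
def secondMoment {d : ℕ} (β₂ : ℝ) (g : ℕ → Vec d) : ℕ → Fin d → ℝ
  | 0 => 0
  | t + 1 => fun i => β₂ * secondMoment β₂ g t i + (1 - β₂) * g (t + 1) i ^ 2

/-- `v̂_t = max (v̂_{t-1}, v_t)` for `t ≥ 1`, coordinate by coordinate, started at `v̂_0`. -/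
def maxSecondMoment {d : ℕ} (β₂ : ℝ) (vhat₀ : Fin d → ℝ) (g : ℕ → Vec d) : ℕ → Fin d → ℝ
  | 0 => vhat₀
  | t + 1 => fun i => max (maxSecondMoment β₂ vhat₀ g t i) (secondMoment β₂ g (t + 1) i)

/-- `p` is a projection of `a` onto `X` under the Mahalanobis distance of the diagonal matrix
`H = diag(h)`: a minimizer over `X` of `‖H^{1/2} (y - a)‖^2`. -/
def IsMahalanobisProj {d : ℕ} (X : Set (Vec d)) (h : Fin d → ℝ) (a p : Vec d) : Prop :=
  p ∈ X ∧ IsMinOn (fun y : Vec d => ∑ i, h i * (y i - a i) ^ 2) X p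

/-- The point `x - α V̂^{-1/2} m`, where `V̂ = diag(v̂)`. If `v̂_i = 0` in a run of the algorithm,
then also `m_i = 0`, and the quotient `0 / 0` is read as `0`. -/
def adaptiveStep {d : ℕ} (α : ℝ) (vhat : Fin d → ℝ) (m x : Vec d) : Vec d :=
  WithLp.toLp 2 fun i => x i - α * (m i / √(vhat i))

variable {Ω Ξ : Type*} [MeasurableSpace Ξ]

/-- The information available at the start of round `t`: the σ-algebra generated by the samples
`ξ_s` and the directions `u_s` of the rounds `1 ≤ s < t`. -/
abbrev history {d : ℕ} (ξ : ℕ → Ω → Ξ) (u : ℕ → Ω → Vec d) (t : ℕ) : MeasurableSpace Ω :=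
  ⨆ s ∈ Set.Ico 1 t,
    (MeasurableSpace.comap (ξ s) inferInstance ⊔ MeasurableSpace.comap (u s) inferInstance)

/-- The gradient estimate `ĝ_t` of the loss `f_t = f(·; ξ_t)` at `x_t` along `u_t`. -/
def ghat {d : ℕ} (f : Vec d → Ξ → ℝ) (μ : ℝ) (ξ : ℕ → Ω → Ξ) (u x : ℕ → Ω → Vec d)
    (ω : Ω) (t : ℕ) : Vec d :=
  zoGrad μ (fun y => f y (ξ t ω)) (u t ω) (x t ω)

/-- `x_1, x_2, …` are the iterates of ZO-AdaMM on the losses `f_t = f(·; ξ_t)`, with random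
directions `u_t`, step sizes `α_t`, parameters `β_{1,t}`, `β_2`, feasible set `X`, starting point
`x₁`, and `m_0 = v_0 = 0`, `v̂_0 = vhat₀`. Index `0` of `x`, `ξ`, `u` is not used. Where `v̂_t` has
a zero coordinate the projection need not be unique: any minimizer is allowed, provided that it
is chosen (measurably) on the basis of the rounds up to `t`. -/
structure IsRun {d : ℕ} (X : Set (Vec d)) (f : Vec d → Ξ → ℝ) (μ : ℝ) (α β₁ : ℕ → ℝ) (β₂ : ℝ)
    (x₁ : Vec d) (vhat₀ : Fin d → ℝ) (ξ : ℕ → Ω → Ξ) (u x : ℕ → Ω → Vec d) : Prop where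
  init : ∀ ω, x 1 ω = x₁
  adapted : ∀ t, 1 ≤ t → Measurable[history ξ u t] (x t)
  step : ∀ t, 1 ≤ t → ∀ ω,
    IsMahalanobisProj X
      (fun i => √(maxSecondMoment β₂ vhat₀ (ghat f μ ξ u x ω) t i))
      (adaptiveStep (α t) (maxSecondMoment β₂ vhat₀ (ghat f μ ξ u x ω) t)
        (momentum β₁ (ghat f μ ξ u x ω) t) (x t ω))
      (x (t + 1) ω)

end ZOAdaMM

end

/-! The proof separates a pathwise regret bound, valid for every sequence of vectors `g t`, from a
probabilistic linearization of the smoothed losses.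

Linearization. The mean of a convex `k` over a unit ball changes, when the ball is translated by `t
• e`, at initial rate `∫ k u * ⟪u, e⟫` over the sphere; by convexity this rate is at most the full
increment at `t = 1`. After rescaling by `μ`, the estimate averaged over its direction is therefore
a subgradient of the smoothed loss (`integral_inner_zoGrad_le_smoothing_sub`). Since `u t` is
independent of all samples and of the earlier directions, Fubini lets `x t` and even a
sample-dependent comparator be frozen while averaging over `u t` (`indepFun_direction`,
`integral_smoothing_sub_le`).

Pathwise bound (`sum_inner_le_of_isMahalanobisProj`). Solving the momentum recursion for `g t`
leaves a term in `m t` and one in `m (t - 1)`. The projection inequality turns the first into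
weighted differences of squared distances, summed by parts, plus `m ^ 2 / √v̂`; Young's inequality
treats the second, and the decay `β₁ / t` leaves the middle term of the bound. Finally `m ^ 2 / √v̂`
is at most a geometric average, of ratio `γ`, of the `|g s i|` (`momentum_sq_mul_le`); summation
costs `1 / (1 - γ)`, and Cauchy-Schwarz against the harmonic sum gives `√(1 + log T)`.

Integrability of the losses at random points follows from integrability at fixed points, because a
convex function on a ball is bounded through finitely many of its values (`abs_le_vertexBound`). -/

open MeasureTheory ProbabilityTheory

noncomputable section

namespace ZOAdaMM

/-! ### Inequalities for weighted sums -/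

/-- Abel summation for a nonincreasing weight `w`, a nondecreasing weight `s` and a sequence `a`
with values in `[0, B]`. -/
lemma sum_mul_sub_succ_le {w s a : ℕ → ℝ} {B : ℝ}
    (hw : ∀ t, 1 ≤ t → w (t + 1) ≤ w t) (hw0 : ∀ t, 1 ≤ t → 0 ≤ w t)
    (hs : ∀ t, 1 ≤ t → s t ≤ s (t + 1)) (hs0 : ∀ t, 1 ≤ t → 0 ≤ s t)
    (ha0 : ∀ t, 1 ≤ t → 0 ≤ a t) (haB : ∀ t, 1 ≤ t → a t ≤ B) {T : ℕ} (hT : 1 ≤ T) :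
    ∑ t ∈ Finset.Icc 1 T, w t * s t * (a t - a (t + 1)) ≤ w 1 * s T * B := by
  have hw1 : ∀ t, 1 ≤ t → w t ≤ w 1 := fun t ht => by
    induction t, ht using Nat.le_induction with
    | base => exact le_rfl
    | succ n hn ih => exact (hw n hn).trans ih
  -- The boundary term of the summation by parts is kept so that the induction closes; it is dropped
  -- only at the end.
  suffices h : ∑ t ∈ Finset.Icc 1 T, w t * s t * (a t - a (t + 1))
      ≤ w 1 * s T * B - w T * s T * a (T + 1) by
    have := mul_nonneg (mul_nonneg (hw0 T hT) (hs0 T hT)) (ha0 (T + 1) (by omega))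
    linarith
  induction T, hT using Nat.le_induction with
  | base =>
    have := mul_le_mul_of_nonneg_left (haB 1 le_rfl) (mul_nonneg (hw0 1 le_rfl) (hs0 1 le_rfl))
    simp only [Finset.Icc_self, Finset.sum_singleton]
    linarith
  | succ n hn ih =>
    rw [Finset.sum_Icc_succ_top (by omega)]
    have h1 : w (n + 1) * s (n + 1) - w n * s n ≤ w 1 * (s (n + 1) - s n) := by
      have := mul_le_mul_of_nonneg_right (hw n hn) (hs0 n hn)
      have := mul_le_mul_of_nonneg_right (hw1 (n + 1) (by omega)) (sub_nonneg.2 (hs n hn))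
      linarith
    have h2 : (w (n + 1) * s (n + 1) - w n * s n) * a (n + 1) ≤ w 1 * (s (n + 1) - s n) * B :=
      (mul_le_mul_of_nonneg_right h1 (ha0 _ (by omega))).trans
        (mul_le_mul_of_nonneg_left (haB _ (by omega))
          (mul_nonneg (hw0 1 le_rfl) (sub_nonneg.2 (hs n hn))))
    linarith

lemma sum_mul_pred_le {a q : ℕ → ℝ} (ha : ∀ t, 1 ≤ t → a (t + 1) ≤ a t) (ha0 : ∀ t, 0 ≤ a t)
    (hq0 : ∀ t, 0 ≤ q t) (hq : q 0 = 0) (T : ℕ) :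
    ∑ t ∈ Finset.Icc 1 T, a t * q (t - 1) ≤ ∑ t ∈ Finset.Icc 1 T, a t * q t := by
  suffices h : ∑ t ∈ Finset.Icc 1 T, a t * q (t - 1)
      ≤ ∑ t ∈ Finset.Icc 1 T, a t * q t - a T * q T by
    have := mul_nonneg (ha0 T) (hq0 T)
    linarith
  induction T with
  | zero => simp [hq]
  | succ n ih =>
    rw [Finset.sum_Icc_succ_top (by omega), Finset.sum_Icc_succ_top (by omega), Nat.add_sub_cancel]
    -- Monotonicity of `a` starts at index 1: for `a t = α / √t` one has `a 0 = 0`. At `n = 0` the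
    -- condition `q 0 = 0` replaces it.
    rcases Nat.eq_zero_or_pos n with rfl | hn
    · simp [hq]
    · have := mul_le_mul_of_nonneg_right (ha n hn) (hq0 n)
      linarith

/-- The exponentially weighted sum `∑_{j ≤ t} γ^{t-j} b_j`. -/
def geomAvg (γ : ℝ) (b : ℕ → ℝ) : ℕ → ℝ
  | 0 => 0
  | t + 1 => γ * geomAvg γ b t + b (t + 1)

lemma geomAvg_nonneg {γ : ℝ} {b : ℕ → ℝ} (hγ : 0 ≤ γ) (hb : ∀ t, 0 ≤ b t) (t : ℕ) :
    0 ≤ geomAvg γ b t := by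
  induction t with
  | zero => exact le_rfl
  | succ n ih => exact add_nonneg (mul_nonneg hγ ih) (hb _)

/-- The recursion writes the sum as `γ` times its shifted version plus `∑ a b`. The shift does not
increase it, since `a` is nonincreasing, and the resulting inequality is solved for the sum. -/
lemma sum_mul_geomAvg_le {γ : ℝ} {a b : ℕ → ℝ} (hγ : 0 ≤ γ) (hγ1 : γ < 1)
    (ha : ∀ t, 1 ≤ t → a (t + 1) ≤ a t) (ha0 : ∀ t, 0 ≤ a t) (hb : ∀ t, 0 ≤ b t) (T : ℕ) :
    ∑ t ∈ Finset.Icc 1 T, a t * geomAvg γ b t ≤ (∑ t ∈ Finset.Icc 1 T, a t * b t) / (1 - γ) := by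
  rw [le_div_iff₀ (by linarith)]
  have h := sum_mul_pred_le ha ha0 (geomAvg_nonneg hγ hb) rfl T
  have h2 : ∑ t ∈ Finset.Icc 1 T, a t * geomAvg γ b t
      = γ * (∑ t ∈ Finset.Icc 1 T, a t * geomAvg γ b (t - 1))
        + ∑ t ∈ Finset.Icc 1 T, a t * b t := by
    rw [Finset.mul_sum, ← Finset.sum_add_distrib]
    refine Finset.sum_congr rfl fun t ht => ?_
    obtain ⟨n, rfl⟩ := Nat.exists_eq_add_of_le' (Finset.mem_Icc.1 ht).1
    simp only [geomAvg, Nat.add_sub_cancel]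
    ring
  have := mul_le_mul_of_nonneg_left h hγ
  linarith

/-- Cauchy-Schwarz; the squares of `1 / √t` add up to the harmonic number, at most `1 + log T`. -/
lemma sum_inv_sqrt_mul_le (b : ℕ → ℝ) (T : ℕ) :
    ∑ t ∈ Finset.Icc 1 T, 1 / √(t : ℝ) * b t
      ≤ √(1 + Real.log T) * √(∑ t ∈ Finset.Icc 1 T, b t ^ 2) := by
  refine (Real.sum_mul_le_sqrt_mul_sqrt _ _ _).trans ?_
  refine mul_le_mul_of_nonneg_right (Real.sqrt_le_sqrt ?_) (Real.sqrt_nonneg _)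
  have h := harmonic_le_one_add_log T
  rw [harmonic_eq_sum_Icc] at h
  push_cast at h
  refine le_trans (le_of_eq (Finset.sum_congr rfl fun t _ => ?_)) h
  rw [div_pow, Real.sq_sqrt (Nat.cast_nonneg _), one_pow, one_div]

/-! ### Pathwise regret for arbitrary gradients -/

section Deterministic

variable {d : ℕ}

lemma secondMoment_nonneg {β₂ : ℝ} (hβ₂ : β₂ ∈ Set.Ico (0 : ℝ) 1) (g : ℕ → Vec d) (t : ℕ)
    (i : Fin d) : 0 ≤ secondMoment β₂ g t i := by
  induction t with
  | zero => exact le_rfl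
  | succ n ih =>
    exact add_nonneg (mul_nonneg hβ₂.1 ih) (mul_nonneg (by linarith [hβ₂.2]) (sq_nonneg _))

lemma secondMoment_le_maxSecondMoment {β₂ : ℝ} {vhat₀ : Fin d → ℝ} (h0 : ∀ i, 0 ≤ vhat₀ i)
    (g : ℕ → Vec d) (t : ℕ) (i : Fin d) :
    secondMoment β₂ g t i ≤ maxSecondMoment β₂ vhat₀ g t i := by
  cases t with
  | zero => exact h0 i
  | succ n => exact le_max_right _ _

lemma maxSecondMoment_le_succ (β₂ : ℝ) (vhat₀ : Fin d → ℝ) (g : ℕ → Vec d) (t : ℕ) (i : Fin d) :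
    maxSecondMoment β₂ vhat₀ g t i ≤ maxSecondMoment β₂ vhat₀ g (t + 1) i :=
  le_max_left _ _

lemma momentum_succ_apply (b : ℕ → ℝ) (g : ℕ → Vec d) (t : ℕ) (i : Fin d) :
    momentum b g (t + 1) i = b (t + 1) * momentum b g t i + (1 - b (t + 1)) * g (t + 1) i := by
  simp [momentum]

/-- The squared momentum is controlled by the second moment. -/
lemma momentum_sq_mul_le {β₁ β₂ γ : ℝ} {b : ℕ → ℝ} (hb0 : ∀ t, 0 ≤ b t) (hb : ∀ t, b t ≤ β₁)
    (hβ₁ : β₁ ∈ Set.Ico (0 : ℝ) 1) (hβ₂ : β₂ ∈ Set.Ico (0 : ℝ) 1)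
    (hβ : β₂ = 0 → β₁ = 0) (hγ : γ = β₁ / √β₂) (g : ℕ → Vec d) (i : Fin d) (t : ℕ) :
    momentum b g t i ^ 2 * √(1 - β₂)
      ≤ geomAvg γ (fun s => |g s i|) t * √(secondMoment β₂ g t i) := by
  have hγ0 : 0 ≤ γ := hγ ▸ div_nonneg hβ₁.1 (Real.sqrt_nonneg _)
  induction t with
  | zero => simp [momentum, geomAvg]
  | succ n ih =>
    have hβ2 : 0 ≤ 1 - β₂ := by linarith [hβ₂.2]
    have hv := secondMoment_nonneg hβ₂ g n i
    have hA := geomAvg_nonneg hγ0 (fun s => abs_nonneg (g s i)) n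
    have hγβ : β₁ = γ * √β₂ := by
      by_cases h : β₂ = 0
      · simp [h, hβ h]
      · have : √β₂ ≠ 0 := (Real.sqrt_pos.2 (lt_of_le_of_ne hβ₂.1 (Ne.symm h))).ne'
        rw [hγ]; field_simp
    -- Keeping only one summand of the new second moment gives the two lower bounds `h1` and `h2`.
    -- The first turns `β₁ = γ * √β₂` into the ratio `γ`; the second absorbs one factor `|g|`.
    have h1 : √β₂ * √(secondMoment β₂ g n i) ≤ √(secondMoment β₂ g (n + 1) i) := by
      rw [← Real.sqrt_mul hβ₂.1]
      exact Real.sqrt_le_sqrt (le_add_of_nonneg_right (mul_nonneg hβ2 (sq_nonneg _)))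
    have h2 : √(1 - β₂) * |g (n + 1) i| ≤ √(secondMoment β₂ g (n + 1) i) := by
      rw [← Real.sqrt_sq_eq_abs, ← Real.sqrt_mul hβ2]
      exact Real.sqrt_le_sqrt (le_add_of_nonneg_left (mul_nonneg hβ₂.1 hv))
    -- Convexity of the square, the defect being `b (1 - b) (m - g) ^ 2`, followed by `b ≤ β₁` and
    -- `1 - b ≤ 1`.
    have h3 : momentum b g (n + 1) i ^ 2 ≤ β₁ * momentum b g n i ^ 2 + g (n + 1) i ^ 2 := by
      rw [momentum_succ_apply]
      have h0 := hb0 (n + 1)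
      have h4 := hb (n + 1)
      have h5 : b (n + 1) ≤ 1 := h4.trans hβ₁.2.le
      have h6 := mul_le_mul_of_nonneg_right h4 (sq_nonneg (momentum b g n i))
      have h7 := mul_nonneg h0 (sq_nonneg (g (n + 1) i))
      have h8 := mul_nonneg (mul_nonneg h0 (sub_nonneg.2 h5))
        (sq_nonneg (momentum b g n i - g (n + 1) i))
      nlinarith
    have hs := Real.sqrt_nonneg (1 - β₂)
    have hsq : g (n + 1) i ^ 2 = |g (n + 1) i| * |g (n + 1) i| := by rw [← sq, sq_abs]
    calc momentum b g (n + 1) i ^ 2 * √(1 - β₂)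
        ≤ (β₁ * momentum b g n i ^ 2 + g (n + 1) i ^ 2) * √(1 - β₂) :=
          mul_le_mul_of_nonneg_right h3 hs
      _ = β₁ * (momentum b g n i ^ 2 * √(1 - β₂))
          + |g (n + 1) i| * (√(1 - β₂) * |g (n + 1) i|) := by rw [hsq]; ring
      _ ≤ β₁ * (geomAvg γ (fun s => |g s i|) n * √(secondMoment β₂ g n i))
          + |g (n + 1) i| * √(secondMoment β₂ g (n + 1) i) :=
          add_le_add (mul_le_mul_of_nonneg_left ih hβ₁.1)
            (mul_le_mul_of_nonneg_left h2 (abs_nonneg _))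
      _ = γ * geomAvg γ (fun s => |g s i|) n * (√β₂ * √(secondMoment β₂ g n i))
          + |g (n + 1) i| * √(secondMoment β₂ g (n + 1) i) := by rw [hγβ]; ring
      _ ≤ γ * geomAvg γ (fun s => |g s i|) n * √(secondMoment β₂ g (n + 1) i)
          + |g (n + 1) i| * √(secondMoment β₂ g (n + 1) i) :=
          add_le_add (mul_le_mul_of_nonneg_left h1 (mul_nonneg hγ0 hA)) le_rfl
      _ = _ := by simp only [geomAvg]; ring

/-- First-order optimality of the projection, in the form needed for the regret analysis. -/
lemma IsMahalanobisProj.sum_mul_sq_le {X : Set (Vec d)} (hX : Convex ℝ X) {h : Fin d → ℝ}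
    (hh : ∀ i, 0 ≤ h i) {a p y : Vec d} (hp : IsMahalanobisProj X h a p) (hy : y ∈ X) :
    ∑ i, h i * (p i - y i) ^ 2 ≤ ∑ i, h i * (a i - y i) ^ 2 := by
  set A := ∑ i, h i * (p i - a i) * (y i - p i) with hA
  set B := ∑ i, h i * (y i - p i) ^ 2 with hB
  have hB0 : 0 ≤ B := Finset.sum_nonneg fun i _ => mul_nonneg (hh i) (sq_nonneg _)
  -- Minimality of `p` against the point `p + ε • (y - p)`, after division by `ε`.
  have key : ∀ ε : ℝ, 0 < ε → ε ≤ 1 → 0 ≤ 2 * A + ε * B := by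
    intro ε h0 h1
    have hmem : p + ε • (y - p) ∈ X := hX.add_smul_sub_mem hp.1 hy ⟨h0.le, h1⟩
    have hmin : ∑ i, h i * (p i - a i) ^ 2 ≤ ∑ i, h i * ((p + ε • (y - p)) i - a i) ^ 2 :=
      hp.2 hmem
    have : ∑ i, h i * ((p + ε • (y - p)) i - a i) ^ 2
        = ∑ i, h i * (p i - a i) ^ 2 + ε * (2 * A + ε * B) := by
      rw [hA, hB]
      simp only [Finset.mul_sum, ← Finset.sum_add_distrib]
      refine Finset.sum_congr rfl fun i _ => ?_
      simp only [PiLp.add_apply, PiLp.smul_apply, PiLp.sub_apply, smul_eq_mul]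
      ring
    rw [this] at hmin
    exact nonneg_of_mul_nonneg_right (by linarith) h0
  have hA0 : 0 ≤ A := by
    by_contra hneg
    push Not at hneg
    rcases hB0.eq_or_lt with h | h
    · have := key 1 one_pos le_rfl
      rw [← h] at this
      linarith
    · have h3 := key (min 1 (-A / B)) (lt_min one_pos (div_pos (by linarith) h)) (min_le_left _ _)
      have h4 : min 1 (-A / B) * B ≤ -A :=
        (mul_le_mul_of_nonneg_right (min_le_right _ _) hB0).trans (by field_simp; rfl)
      linarith
  have hid : ∑ i, h i * (a i - y i) ^ 2
      = ∑ i, h i * (p i - y i) ^ 2 + ∑ i, h i * (p i - a i) ^ 2 + 2 * A := by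
    rw [hA]
    simp only [Finset.mul_sum, ← Finset.sum_add_distrib]
    refine Finset.sum_congr rfl fun i _ => ?_
    ring
  have : 0 ≤ ∑ i, h i * (p i - a i) ^ 2 :=
    Finset.sum_nonneg fun i _ => mul_nonneg (hh i) (sq_nonneg _)
  linarith

/-- Completing the square. For `h = 0` the quotient is `0` by convention, and the bound survives
because `m = 0` as well. -/
lemma neg_mul_le_young {a h m δ : ℝ} (ha : 0 < a) (hh : 0 ≤ h) (hm : h = 0 → m = 0) :
    -(m * δ) ≤ a / 2 * (m ^ 2 / h) + h * δ ^ 2 / (2 * a) := by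
  rcases hh.eq_or_lt with h0 | h0
  · simp [← h0, hm h0.symm]
  · have : a / 2 * (m ^ 2 / h) + h * δ ^ 2 / (2 * a) + m * δ
        = (a * m + h * δ) ^ 2 / (2 * a * h) := by
      field_simp
      ring
    have h2 : 0 ≤ (a * m + h * δ) ^ 2 / (2 * a * h) := by positivity
    linarith

/-- One round of the adaptive method: the inner product of the momentum with `x_t - y`. -/
lemma sum_momentum_mul_le {X : Set (Vec d)} (hX : Convex ℝ X) {v : Fin d → ℝ} {a : ℝ} (ha : 0 < a)
    {m x p y : Vec d} (hm : ∀ i, √(v i) = 0 → m i = 0)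
    (hp : IsMahalanobisProj X (fun i => √(v i)) (adaptiveStep a v m x) p) (hy : y ∈ X) :
    ∑ i, m i * (x i - y i)
      ≤ ∑ i, (√(v i) * ((x i - y i) ^ 2 - (p i - y i) ^ 2) / (2 * a)
          + a / 2 * (m i ^ 2 / √(v i))) := by
  have h := hp.sum_mul_sq_le hX (fun i => Real.sqrt_nonneg _) hy
  have h2 : ∀ i, √(v i) * (adaptiveStep a v m x i - y i) ^ 2
      = √(v i) * (x i - y i) ^ 2 - 2 * a * (m i * (x i - y i)) + a ^ 2 * (m i ^ 2 / √(v i)) := by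
    intro i
    by_cases h0 : √(v i) = 0
    · simp [h0, hm i h0]
    · simp only [adaptiveStep]
      field_simp
      ring
  simp only [h2, Finset.sum_add_distrib, Finset.sum_sub_distrib, ← Finset.mul_sum] at h
  simp only [Finset.sum_add_distrib, ← Finset.mul_sum, mul_sub, ← Finset.sum_div,
    Finset.sum_sub_distrib]
  simp only [mul_sub, Finset.sum_sub_distrib] at h
  rw [← sub_nonneg] at h ⊢
  have : (∑ i, √(v i) * (x i - y i) ^ 2 - ∑ i, √(v i) * (p i - y i) ^ 2) / (2 * a)
      + a / 2 * ∑ i, m i ^ 2 / √(v i) - (∑ i, m i * x i - ∑ i, m i * y i)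
      = (∑ i, √(v i) * (x i - y i) ^ 2 - 2 * a * (∑ i, m i * x i - ∑ i, m i * y i)
        + a ^ 2 * ∑ i, m i ^ 2 / √(v i) - ∑ i, √(v i) * (p i - y i) ^ 2) / (2 * a) := by
    field_simp
    ring
  rw [this]
  exact div_nonneg (by linarith) (by positivity)

/-- The regret of the adaptive momentum method on linear losses, for an arbitrary sequence of
gradients `g`. -/
theorem sum_inner_le_of_isMahalanobisProj {X : Set (Vec d)} (hX : Convex ℝ X) {D : ℝ}
    (hD : ∀ y ∈ X, ∀ z ∈ X, ∀ i, |y i - z i| ≤ D) {α β₁ β₂ γ : ℝ} (hα : 0 < α)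
    (hβ₁ : β₁ ∈ Set.Ico (0 : ℝ) 1) (hβ₂ : β₂ ∈ Set.Ico (0 : ℝ) 1)
    (hβ : β₂ = 0 → β₁ = 0) (hγ : γ = β₁ / √β₂) (hγ1 : γ < 1)
    {vhat₀ : Fin d → ℝ} (hv0 : ∀ i, 0 ≤ vhat₀ i) {g x : ℕ → Vec d} (hx1 : x 1 ∈ X)
    (hstep : ∀ t, 1 ≤ t → IsMahalanobisProj X (fun i => √(maxSecondMoment β₂ vhat₀ g t i))
      (adaptiveStep (α / √(t : ℝ)) (maxSecondMoment β₂ vhat₀ g t)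
        (momentum (fun t => β₁ / (t : ℝ)) g t) (x t)) (x (t + 1)))
    {y : Vec d} (hy : y ∈ X) {T : ℕ} (hT : 1 ≤ T) :
    ∑ t ∈ Finset.Icc 1 T, ∑ i, g t i * (x t i - y i)
      ≤ ∑ i, (D ^ 2 * √(T : ℝ) * √(maxSecondMoment β₂ vhat₀ g T i) / (2 * α * (1 - β₁))
        + D ^ 2 / (2 * (1 - β₁)) * ∑ t ∈ Finset.Icc 1 T,
            β₁ * √(maxSecondMoment β₂ vhat₀ g t i) / (α * √(t : ℝ))
        + α * √(1 + Real.log T) * √(∑ t ∈ Finset.Icc 1 T, g t i ^ 2)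
            / ((1 - β₁) * (1 - γ) * √(1 - β₂))) := by
  set b : ℕ → ℝ := fun t => β₁ / (t : ℝ) with hb
  set h : ℕ → Fin d → ℝ := fun t i => √(maxSecondMoment β₂ vhat₀ g t i) with hh
  set m := momentum b g with hm
  set q : ℕ → Fin d → ℝ := fun t i => m t i ^ 2 / h t i with hq
  set a : ℕ → ℝ := fun t => α / √(t : ℝ) with ha
  set w : ℕ → ℝ := fun t => 1 / (1 - b t) with hw
  have hβ1 : 0 < 1 - β₁ := by linarith [hβ₁.2]
  have hβ2 : 0 < 1 - β₂ := by linarith [hβ₂.2]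
  have hγ0 : 0 ≤ γ := hγ ▸ div_nonneg hβ₁.1 (Real.sqrt_nonneg _)
  have hb0 : ∀ t, 0 ≤ b t := fun t => div_nonneg hβ₁.1 (Nat.cast_nonneg _)
  have hbβ : ∀ t, b t ≤ β₁ := by
    intro t
    rcases Nat.eq_zero_or_pos t with rfl | ht
    · simpa [hb] using hβ₁.1
    · exact div_le_self hβ₁.1 (by exact_mod_cast ht)
  have hb1 : ∀ t, 0 < 1 - b t := fun t => by linarith [hbβ t]
  have hbanti : ∀ t, 1 ≤ t → b (t + 1) ≤ b t := fun t ht =>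
    div_le_div_of_nonneg_left hβ₁.1 (by exact_mod_cast ht) (by push_cast; linarith)
  have hw0 : ∀ t, 0 < w t := fun t => one_div_pos.2 (hb1 t)
  have hwanti : ∀ t, 1 ≤ t → w (t + 1) ≤ w t := fun t ht =>
    one_div_le_one_div_of_le (hb1 t) (by linarith [hbanti t ht])
  have hw1 : w 1 = 1 / (1 - β₁) := by simp [hw, hb]
  have hwle : ∀ t, w t ≤ 1 / (1 - β₁) := fun t =>
    one_div_le_one_div_of_le hβ1 (by linarith [hbβ t])
  have hh0 : ∀ t i, 0 ≤ h t i := fun t i => Real.sqrt_nonneg _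
  have hhmono : ∀ t i, h t i ≤ h (t + 1) i := fun t i =>
    Real.sqrt_le_sqrt (maxSecondMoment_le_succ _ _ _ _ _)
  have ha0 : ∀ t, 0 ≤ a t := fun t => div_nonneg hα.le (Real.sqrt_nonneg _)
  have hapos : ∀ t, 1 ≤ t → 0 < a t := fun t ht =>
    div_pos hα (Real.sqrt_pos.2 (by exact_mod_cast ht))
  have haanti : ∀ t, 1 ≤ t → a (t + 1) ≤ a t := fun t ht =>
    div_le_div_of_nonneg_left hα.le (Real.sqrt_pos.2 (by exact_mod_cast ht))
      (Real.sqrt_le_sqrt (by push_cast; linarith))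
  have hq0 : ∀ t i, 0 ≤ q t i := fun t i => div_nonneg (sq_nonneg _) (hh0 t i)
  have hmsq : ∀ t i, m t i ^ 2 * √(1 - β₂) ≤ geomAvg γ (fun s => |g s i|) t * h t i := fun t i =>
    (momentum_sq_mul_le hb0 hbβ hβ₁ hβ₂ hβ hγ g i t).trans
      (mul_le_mul_of_nonneg_left (Real.sqrt_le_sqrt (secondMoment_le_maxSecondMoment hv0 g t i))
        (geomAvg_nonneg hγ0 (fun s => abs_nonneg _) t))
  have hsq2 : 0 < √(1 - β₂) := Real.sqrt_pos.2 hβ2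
  -- This makes the convention `0 / 0 = 0` in the adaptive step and in `q` harmless.
  have hm0 : ∀ t i, h t i = 0 → m t i = 0 := by
    intro t i h0
    have h1 := hmsq t i
    rw [h0, mul_zero] at h1
    have h2 : m t i ^ 2 ≤ 0 := by
      by_contra hc
      push Not at hc
      exact absurd h1 (not_le.2 (mul_pos hc hsq2))
    exact pow_eq_zero_iff two_ne_zero |>.1 (le_antisymm h2 (sq_nonneg _))
  have hqA : ∀ t i, q t i ≤ geomAvg γ (fun s => |g s i|) t / √(1 - β₂) := by
    intro t i
    rcases (hh0 t i).eq_or_lt with h0 | h0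
    · simp only [hq, ← h0, div_zero]
      exact div_nonneg (geomAvg_nonneg hγ0 (fun s => abs_nonneg _) t) hsq2.le
    · rw [hq, div_le_div_iff₀ h0 hsq2]
      exact hmsq t i
  have hxX : ∀ t, 1 ≤ t → x t ∈ X := by
    intro t ht
    induction t, ht using Nat.le_induction with
    | base => exact hx1
    | succ n hn _ => exact (hstep n hn).1
  have hδ : ∀ t, 1 ≤ t → ∀ i, (x t i - y i) ^ 2 ≤ D ^ 2 := fun t ht i =>
    sq_le_sq' (by linarith [neg_abs_le (x t i - y i), hD _ (hxX t ht) _ hy i])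
      ((le_abs_self _).trans (hD _ (hxX t ht) _ hy i))
  -- the bound for a single round
  have hround : ∀ t ∈ Finset.Icc 1 T, ∑ i, g t i * (x t i - y i) ≤
      ∑ i, (w t * (√(t : ℝ) * h t i / (2 * α)) * ((x t i - y i) ^ 2 - (x (t + 1) i - y i) ^ 2)
        + 1 / (1 - β₁) / 2 * (a t * q t i) + 1 / (1 - β₁) / 2 * (a t * q (t - 1) i)
        + D ^ 2 / (2 * (1 - β₁)) * (β₁ * h t i / (α * √(t : ℝ)))) := by
    intro t ht
    have ht1 := (Finset.mem_Icc.1 ht).1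
    have h1 := sum_momentum_mul_le hX (hapos t ht1) (hm0 t) (hstep t ht1) hy
    have ht0 : (0 : ℝ) < t := by exact_mod_cast ht1
    have hst : 0 < √(t : ℝ) := Real.sqrt_pos.2 ht0
    -- The momentum recursion solved for `g t`; this is the origin of the weight `w t = 1 / (1 - b
    -- t)`.
    have hgm : ∀ i, g t i = w t * m t i - b t * w t * m (t - 1) i := by
      intro i
      obtain ⟨n, rfl⟩ := Nat.exists_eq_add_of_le' ht1
      have := (hb1 (n + 1)).ne'
      rw [Nat.add_sub_cancel, hm, momentum_succ_apply, hw]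
      field_simp
      ring
    have h2 : ∑ i, g t i * (x t i - y i)
        = w t * ∑ i, m t i * (x t i - y i)
          + ∑ i, b t * w t * -(m (t - 1) i * (x t i - y i)) := by
      rw [Finset.mul_sum, ← Finset.sum_add_distrib]
      refine Finset.sum_congr rfl fun i _ => ?_
      rw [hgm]
      ring
    rw [h2]
    refine (add_le_add (mul_le_mul_of_nonneg_left h1 (hw0 t).le) le_rfl).trans ?_
    rw [Finset.mul_sum, ← Finset.sum_add_distrib]
    refine Finset.sum_le_sum fun i _ => ?_
    -- The old momentum is paired with the old weight `h (t - 1)` but the current step `a t`. The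
    -- result `a t * q (t - 1)` can then be shifted by `sum_mul_pred_le`.
    have hy1 := neg_mul_le_young (δ := x t i - y i) (hapos t ht1) (hh0 (t - 1) i) (hm0 (t - 1) i)
    have hhle : h (t - 1) i ≤ h t i := by
      obtain ⟨n, rfl⟩ := Nat.exists_eq_add_of_le' ht1
      exact hhmono n i
    have hy2 : h (t - 1) i * (x t i - y i) ^ 2 / (2 * a t) ≤ h t i * D ^ 2 / (2 * a t) :=
      div_le_div_of_nonneg_right
        (mul_le_mul hhle (hδ t ht1 i) (sq_nonneg _) (hh0 t i)) (by linarith [hapos t ht1])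
    have hbw : b t * w t ≤ b t * (1 / (1 - β₁)) := mul_le_mul_of_nonneg_left (hwle t) (hb0 t)
    have hbw0 : 0 ≤ b t * w t := mul_nonneg (hb0 t) (hw0 t).le
    have hbw1 : b t * w t ≤ 1 / (1 - β₁) :=
      hbw.trans (mul_le_of_le_one_left (one_div_pos.2 hβ1).le ((hbβ t).trans hβ₁.2.le))
    have e1 : w t * (h t i * ((x t i - y i) ^ 2 - (x (t + 1) i - y i) ^ 2) / (2 * a t))
        = w t * (√(t : ℝ) * h t i / (2 * α))
          * ((x t i - y i) ^ 2 - (x (t + 1) i - y i) ^ 2) := by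
      simp only [ha]
      field_simp
    have e2 : w t * (a t / 2 * q t i) ≤ 1 / (1 - β₁) / 2 * (a t * q t i) := by
      have := mul_le_mul_of_nonneg_right (hwle t) (mul_nonneg (ha0 t) (hq0 t i))
      linarith
    have e3 : b t * w t * (a t / 2 * q (t - 1) i)
        ≤ 1 / (1 - β₁) / 2 * (a t * q (t - 1) i) := by
      have := mul_le_mul_of_nonneg_right hbw1 (mul_nonneg (ha0 t) (hq0 (t - 1) i))
      linarith
    -- Here the decay of `b t` must be kept: `(β₁ / t) / a t = β₁ / (α * √t)`.
    have e4 : b t * w t * (h t i * D ^ 2 / (2 * a t))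
        ≤ D ^ 2 / (2 * (1 - β₁)) * (β₁ * h t i / (α * √(t : ℝ))) := by
      have h0 : 0 ≤ h t i * D ^ 2 / (2 * a t) :=
        div_nonneg (mul_nonneg (hh0 t i) (sq_nonneg _)) (by linarith [hapos t ht1])
      refine (mul_le_mul_of_nonneg_right hbw h0).trans (le_of_eq ?_)
      have hs : (t : ℝ) = √(t : ℝ) * √(t : ℝ) := (Real.mul_self_sqrt ht0.le).symm
      simp only [hb, ha]
      have hdiv : β₁ / (t : ℝ) = β₁ / (√(t : ℝ) * √(t : ℝ)) := by rw [← hs]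
      rw [hdiv]
      field_simp
    have e5 : b t * w t * -(m (t - 1) i * (x t i - y i))
        ≤ b t * w t * (a t / 2 * q (t - 1) i) + b t * w t * (h t i * D ^ 2 / (2 * a t)) := by
      rw [← mul_add]
      exact mul_le_mul_of_nonneg_left (hy1.trans (add_le_add le_rfl hy2)) hbw0
    rw [mul_add]
    change w t * (h t i * ((x t i - y i) ^ 2 - (x (t + 1) i - y i) ^ 2) / (2 * a t))
      + w t * (a t / 2 * q t i) + _ ≤ _
    linarith
  refine (Finset.sum_le_sum hround).trans ?_
  rw [Finset.sum_comm]
  refine Finset.sum_le_sum fun i _ => ?_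
  simp only [Finset.sum_add_distrib, ← Finset.mul_sum]
  -- Summation by parts needs `√t * h t` to be nondecreasing, which is what the running maximum in
  -- `v̂` ensures.
  have f1 : ∑ t ∈ Finset.Icc 1 T,
      w t * (√(t : ℝ) * h t i / (2 * α)) * ((x t i - y i) ^ 2 - (x (t + 1) i - y i) ^ 2)
      ≤ D ^ 2 * √(T : ℝ) * h T i / (2 * α * (1 - β₁)) := by
    refine (sum_mul_sub_succ_le (a := fun t => (x t i - y i) ^ 2) hwanti (fun t _ => (hw0 t).le)
      (s := fun t => √(t : ℝ) * h t i / (2 * α)) (fun t _ => ?_) (fun t _ => ?_)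
      (fun t _ => sq_nonneg _) (fun t ht => hδ t ht i) hT).trans (le_of_eq ?_)
    · exact div_le_div_of_nonneg_right
        (mul_le_mul (Real.sqrt_le_sqrt (by push_cast; linarith)) (hhmono t i) (hh0 t i)
          (Real.sqrt_nonneg _)) (by positivity)
    · exact div_nonneg (mul_nonneg (Real.sqrt_nonneg _) (hh0 t i)) (by positivity)
    · rw [hw1]
      field_simp
  have f2 := sum_mul_pred_le haanti ha0 (q := fun t => q t i) (fun t => hq0 t i)
    (by simp [hq, hm, momentum]) T
  have f3 : ∑ t ∈ Finset.Icc 1 T, a t * q t i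
      ≤ α * √(1 + Real.log T) * √(∑ t ∈ Finset.Icc 1 T, g t i ^ 2) / ((1 - γ) * √(1 - β₂)) := by
    calc ∑ t ∈ Finset.Icc 1 T, a t * q t i
        ≤ ∑ t ∈ Finset.Icc 1 T, a t * geomAvg γ (fun s => |g s i|) t / √(1 - β₂) :=
          Finset.sum_le_sum fun t _ => by
            rw [mul_div_assoc]
            exact mul_le_mul_of_nonneg_left (hqA t i) (ha0 t)
      _ ≤ (∑ t ∈ Finset.Icc 1 T, a t * |g t i|) / (1 - γ) / √(1 - β₂) := by
          rw [← Finset.sum_div]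
          exact div_le_div_of_nonneg_right
            (sum_mul_geomAvg_le hγ0 hγ1 haanti ha0 (fun t => abs_nonneg _) T) hsq2.le
      _ ≤ α * (√(1 + Real.log T) * √(∑ t ∈ Finset.Icc 1 T, g t i ^ 2)) / (1 - γ)
            / √(1 - β₂) := by
          refine div_le_div_of_nonneg_right (div_le_div_of_nonneg_right ?_ (by linarith)) hsq2.le
          have := mul_le_mul_of_nonneg_left (sum_inv_sqrt_mul_le (fun t => |g t i|) T) hα.le
          rw [Finset.mul_sum] at this
          simp only [sq_abs] at this
          refine le_trans (le_of_eq (Finset.sum_congr rfl fun t _ => ?_)) this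
          simp only [ha]
          ring
      _ = _ := by rw [div_div]; ring
  have f4 : 1 / (1 - β₁) * ∑ t ∈ Finset.Icc 1 T, a t * q t i
      ≤ α * √(1 + Real.log T) * √(∑ t ∈ Finset.Icc 1 T, g t i ^ 2)
            / ((1 - β₁) * (1 - γ) * √(1 - β₂)) := by
    refine (mul_le_mul_of_nonneg_left f3 (one_div_pos.2 hβ1).le).trans (le_of_eq ?_)
    have : (1 - γ) ≠ 0 := by linarith
    field_simp
  have f5 := mul_le_mul_of_nonneg_left f2 (one_div_pos.2 hβ1).le
  linarith

end Deterministic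

/-! ### Polar coordinates -/

section Polar

open Metric Module Filter Topology

variable {E : Type*} [NormedAddCommGroup E] [NormedSpace ℝ E] [MeasurableSpace E] [BorelSpace E]
  [FiniteDimensional ℝ E] [Nontrivial E] (ν : Measure E) [ν.IsAddHaarMeasure]

/-- Integration in polar coordinates. -/
lemma integral_eq_integral_toSphere {f : E → ℝ} (hf : Integrable f ν) :
    Integrable (fun u : sphere (0 : E) 1 =>
        ∫ r in Set.Ioi (0 : ℝ), r ^ (finrank ℝ E - 1) * f (r • (u : E))) ν.toSphere ∧
      ∫ x, f x ∂ν = ∫ u : sphere (0 : E) 1,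
        (∫ r in Set.Ioi (0 : ℝ), r ^ (finrank ℝ E - 1) * f (r • (u : E))) ∂ν.toSphere := by
  set n := finrank ℝ E - 1 with hn
  set F : sphere (0 : E) 1 × Set.Ioi (0 : ℝ) → ℝ := fun p => f ((p.2 : ℝ) • (p.1 : E)) with hF
  have hmp := ν.measurePreserving_homeomorphUnitSphereProd
  have hemb := (homeomorphUnitSphereProd E).measurableEmbedding
  have hcomp : F ∘ homeomorphUnitSphereProd E = fun x : ({0}ᶜ : Set E) => f x := by
    ext x
    have h := (homeomorphUnitSphereProd E).symm_apply_apply x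
    conv_rhs => rw [← h]
    rfl
  have hint : Integrable F (ν.toSphere.prod (.volumeIoiPow n)) := by
    rw [← hmp.integrable_comp_emb hemb, hcomp]
    exact (integrableOn_iff_comap_subtypeVal (measurableSet_singleton _).compl).1 hf.integrableOn
  have hinner : ∀ u : sphere (0 : E) 1, ∫ r, F (u, r) ∂(Measure.volumeIoiPow n)
      = ∫ r in Set.Ioi (0 : ℝ), r ^ n * f (r • (u : E)) := by
    intro u
    simp only [Measure.volumeIoiPow, ENNReal.ofReal]
    rw [integral_withDensity_eq_integral_smul,
      integral_subtype_comap measurableSet_Ioi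
        fun a : ℝ => Real.toNNReal (a ^ n) • f (a • (u : E)),
      setIntegral_congr_fun measurableSet_Ioi fun x hx => ?_]
    · rw [NNReal.smul_def, Real.coe_toNNReal _ (pow_nonneg hx.out.le _), smul_eq_mul]
    · exact (measurable_subtype_coe.pow_const _).real_toNNReal
  simp only [← hinner]
  refine ⟨hint.integral_prod_left, ?_⟩
  rw [← integral_prod _ hint, ← hmp.integral_comp hemb]
  change _ = ∫ x, (F ∘ homeomorphUnitSphereProd E) x ∂_
  rw [hcomp, integral_subtype_comap (measurableSet_singleton _).compl, restrict_compl_singleton]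

end Polar

/-! ### Ball means of convex functions and surface integrals -/

section Smoothing

open Metric Module Filter Topology

variable {E : Type*} [NormedAddCommGroup E] [InnerProductSpace ℝ E]

/-- The distance from the origin, in the direction `u`, to the unit sphere centred at `e`. -/
def shiftedRadius (e u : E) : ℝ := inner ℝ u e + √(1 - ‖e‖ ^ 2 + inner ℝ u e ^ 2)

/-- Membership is a quadratic inequality in `r`. As `‖e‖ < 1`, the origin is inside the ball and the
smaller root is not positive, so only the larger root constrains `r > 0`. -/
lemma smul_mem_closedBall_iff {e u : E} (he : ‖e‖ < 1) (hu : ‖u‖ = 1) {r : ℝ} (hr : 0 < r) :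
    r • u ∈ closedBall e 1 ↔ r ≤ shiftedRadius e u := by
  have hS : 0 < 1 - ‖e‖ ^ 2 := by nlinarith [norm_nonneg e]
  have hc : |inner ℝ u e| ≤ √(1 - ‖e‖ ^ 2 + inner ℝ u e ^ 2) := by
    rw [← Real.sqrt_sq_eq_abs]
    exact Real.sqrt_le_sqrt (by linarith)
  have h1 : ‖r • u - e‖ ^ 2 = (r - inner ℝ u e) ^ 2 - (1 - ‖e‖ ^ 2 + inner ℝ u e ^ 2) + 1 := by
    rw [norm_sub_sq_real, norm_smul, hu, real_inner_smul_left, mul_one, Real.norm_eq_abs, sq_abs]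
    ring
  rw [mem_closedBall, dist_eq_norm, shiftedRadius, ← sq_le_one_iff₀ (norm_nonneg _), h1]
  constructor
  · intro h
    have := Real.le_sqrt_of_sq_le
      (show (r - inner ℝ u e) ^ 2 ≤ 1 - ‖e‖ ^ 2 + inner ℝ u e ^ 2 by linarith)
    linarith
  · intro h
    have h2 : |r - inner ℝ u e| ≤ √(1 - ‖e‖ ^ 2 + inner ℝ u e ^ 2) :=
      abs_le.2 ⟨by linarith [le_abs_self (inner ℝ u e)], by linarith⟩
    have h3 := pow_le_pow_left₀ (abs_nonneg _) h2 2
    rw [sq_abs, Real.sq_sqrt (by positivity)] at h3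
    linarith

lemma shiftedRadius_nonneg {e u : E} (he : ‖e‖ < 1) : 0 ≤ shiftedRadius e u := by
  have hS : 0 < 1 - ‖e‖ ^ 2 := by nlinarith [norm_nonneg e]
  have hc : |inner ℝ u e| ≤ √(1 - ‖e‖ ^ 2 + inner ℝ u e ^ 2) := by
    rw [← Real.sqrt_sq_eq_abs]
    exact Real.sqrt_le_sqrt (by linarith)
  rw [shiftedRadius]
  linarith [neg_abs_le (inner ℝ u e)]

/-- A bound uniform in `u`, for dominated convergence: one `‖e‖` comes from the inner product, the
other from `1 - ‖e‖ ≤ √S ≤ 1`. -/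
lemma abs_shiftedRadius_sub_one_le {e u : E} (he : ‖e‖ < 1) (hu : ‖u‖ = 1) :
    |shiftedRadius e u - 1| ≤ 2 * ‖e‖ := by
  have hc : |inner ℝ u e| ≤ ‖e‖ := by simpa [hu] using abs_real_inner_le_norm u e
  have hc2 : inner ℝ u e ^ 2 ≤ ‖e‖ ^ 2 := sq_le_sq' (by linarith [neg_abs_le (inner ℝ u e)])
    ((le_abs_self _).trans hc)
  set S := 1 - ‖e‖ ^ 2 + inner ℝ u e ^ 2 with hS
  have h0 := norm_nonneg e
  have h1 : √S ≤ 1 := Real.sqrt_le_one.2 (by linarith)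
  have h2 : 1 - ‖e‖ ≤ √S := Real.le_sqrt_of_sq_le (by nlinarith [sq_nonneg (inner ℝ u e)])
  have h3 := abs_le.1 hc
  rw [shiftedRadius, abs_le]
  constructor <;> linarith

/-- Under the root `t` occurs only squared, so the root is stationary at `0` and only the linear
term contributes. -/
lemma hasDerivAt_shiftedRadius (e u : E) :
    HasDerivAt (fun t : ℝ => shiftedRadius (t • e) u) (inner ℝ u e) 0 := by
  have h : ∀ t : ℝ, shiftedRadius (t • e) u
      = t * inner ℝ u e + √(1 + t ^ 2 * (inner ℝ u e ^ 2 - ‖e‖ ^ 2)) := by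
    intro t
    rw [shiftedRadius, real_inner_smul_right, norm_smul, mul_pow, Real.norm_eq_abs, sq_abs]
    ring_nf
  simp only [h]
  have h1 : HasDerivAt (fun t : ℝ => 1 + t ^ 2 * (inner ℝ u e ^ 2 - ‖e‖ ^ 2)) 0 0 := by
    have := (((hasDerivAt_id (0 : ℝ)).pow 2).mul_const (inner ℝ u e ^ 2 - ‖e‖ ^ 2)).const_add 1
    simpa using this
  have h2 := h1.sqrt (by simp)
  have h3 := ((hasDerivAt_id (0 : ℝ)).mul_const (inner ℝ u e)).add h2
  simp only [zero_div, one_mul, add_zero] at h3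
  exact h3

variable [MeasurableSpace E] [BorelSpace E] [FiniteDimensional ℝ E] [Nontrivial E]
  (ν : Measure E) [ν.IsAddHaarMeasure]

lemma setIntegral_closedBall_eq_integral_toSphere {k : E → ℝ} (hk : Continuous k) {e : E}
    (he : ‖e‖ < 1) :
    Integrable (fun u : sphere (0 : E) 1 =>
        ∫ r in (0 : ℝ)..shiftedRadius e u, r ^ (finrank ℝ E - 1) * k (r • (u : E))) ν.toSphere ∧
      ∫ w in closedBall e 1, k w ∂ν = ∫ u : sphere (0 : E) 1,
        (∫ r in (0 : ℝ)..shiftedRadius e u,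
          r ^ (finrank ℝ E - 1) * k (r • (u : E))) ∂ν.toSphere := by
  have hint : Integrable ((closedBall e 1).indicator k) ν :=
    (integrable_indicator_iff measurableSet_closedBall).2
      (hk.continuousOn.integrableOn_compact (isCompact_closedBall _ _))
  have h := integral_eq_integral_toSphere ν hint
  have hinner : ∀ u : sphere (0 : E) 1,
      ∫ r in Set.Ioi (0 : ℝ), r ^ (finrank ℝ E - 1) * (closedBall e 1).indicator k (r • (u : E))
      = ∫ r in (0 : ℝ)..shiftedRadius e u, r ^ (finrank ℝ E - 1) * k (r • (u : E)) := by
    intro u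
    rw [intervalIntegral.integral_of_le (shiftedRadius_nonneg he), ← Set.Ioi_inter_Iic,
      ← setIntegral_indicator measurableSet_Iic]
    refine setIntegral_congr_fun measurableSet_Ioi fun r hr => ?_
    have hiff := smul_mem_closedBall_iff he (norm_eq_of_mem_sphere u) hr
    by_cases hm : r ≤ shiftedRadius e u
    · rw [Set.indicator_of_mem (hiff.2 hm), Set.indicator_of_mem (Set.mem_Iic.2 hm)]
    · rw [Set.indicator_of_notMem (fun h => hm (hiff.1 h)),
        Set.indicator_of_notMem (fun h => hm (Set.mem_Iic.1 h)), mul_zero]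
  simp only [hinner] at h
  rwa [integral_indicator measurableSet_closedBall] at h

/-- The derivative of the integral over a moving unit ball is a surface integral. -/
lemma tendsto_slope_setIntegral_closedBall {k : E → ℝ} (hk : Continuous k) (e : E) :
    Tendsto (fun t : ℝ => t⁻¹ * (∫ w in closedBall (t • e) 1, k w ∂ν
        - ∫ w in closedBall (0 : E) 1, k w ∂ν)) (𝓝[>] 0)
      (𝓝 (∫ u : sphere (0 : E) 1, k u * inner ℝ (u : E) e ∂ν.toSphere)) := by
  set n := finrank ℝ E - 1 with hn
  set K : E → ℝ → ℝ := fun u r => r ^ n * k (r • u) with hK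
  have hKc : ∀ u, Continuous (K u) := fun u => by fun_prop
  obtain ⟨M, hM⟩ := (isCompact_closedBall (0 : E) 3).exists_bound_of_continuousOn hk.continuousOn
  have hsmall : ∀ᶠ t : ℝ in 𝓝[>] 0, 0 < t ∧ ‖t • e‖ < 1 / 2 := by
    refine (eventually_mem_nhdsWithin (s := Set.Ioi (0 : ℝ))).and (nhdsWithin_le_nhds ?_)
    have : Tendsto (fun t : ℝ => ‖t • e‖) (𝓝 0) (𝓝 0) := by
      have hc : Continuous (fun t : ℝ => ‖t • e‖) := by fun_prop
      simpa using hc.tendsto 0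
    exact this.eventually (gt_mem_nhds (by norm_num))
  have hr0 : ∀ u : sphere (0 : E) 1, shiftedRadius ((0 : ℝ) • e) (u : E) = 1 := by
    intro u; simp [shiftedRadius]
  have hslope : ∀ᶠ t : ℝ in 𝓝[>] 0, ∫ u : sphere (0 : E) 1,
        t⁻¹ * ((∫ r in (0 : ℝ)..shiftedRadius (t • e) u, K u r) - ∫ r in (0 : ℝ)..1, K u r)
          ∂ν.toSphere
      = t⁻¹ * (∫ w in closedBall (t • e) 1, k w ∂ν - ∫ w in closedBall (0 : E) 1, k w ∂ν) := by
    filter_upwards [hsmall] with t ht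
    have h1 := setIntegral_closedBall_eq_integral_toSphere ν hk
      (ht.2.trans (by norm_num : (1 / 2 : ℝ) < 1))
    have h2 := setIntegral_closedBall_eq_integral_toSphere ν hk
      (show ‖(0 : ℝ) • e‖ < 1 by simp)
    simp only [hr0] at h2
    rw [zero_smul] at h2
    rw [integral_const_mul, integral_sub h1.1 h2.1, ← h1.2, ← h2.2]
  refine Tendsto.congr' hslope ?_
  -- For `‖t • e‖ < 1 / 2` the radii are at most `2`, hence the factor `2 ^ n`, and the points `r •
  -- u` stay in the ball where `M` bounds `k`.
  refine tendsto_integral_filter_of_dominated_convergence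
    (fun _ => 2 ^ n * M * (2 * ‖e‖)) ?_ ?_ (integrable_const _) ?_
  · filter_upwards [hsmall] with t ht
    have h1 := setIntegral_closedBall_eq_integral_toSphere ν hk
      (ht.2.trans (by norm_num : (1 / 2 : ℝ) < 1))
    have h2 := setIntegral_closedBall_eq_integral_toSphere ν hk
      (show ‖(0 : ℝ) • e‖ < 1 by simp)
    simp only [hr0] at h2
    exact ((h1.1.sub h2.1).const_mul _).aestronglyMeasurable
  · filter_upwards [hsmall] with t ht
    refine Eventually.of_forall fun u => ?_
    have hu := norm_eq_of_mem_sphere u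
    have hd := abs_shiftedRadius_sub_one_le
      (ht.2.trans (by norm_num : (1 / 2 : ℝ) < 1)) hu
    have hnn := shiftedRadius_nonneg (u := (u : E)) (ht.2.trans (by norm_num : (1 / 2 : ℝ) < 1))
    have hle2 : shiftedRadius (t • e) (u : E) ≤ 2 := by linarith [(abs_le.1 hd).2]
    rw [intervalIntegral.integral_interval_sub_left ((hKc u).intervalIntegrable _ _)
      ((hKc u).intervalIntegrable _ _)]
    have hb : ‖∫ r in (1 : ℝ)..shiftedRadius (t • e) u, K u r‖
        ≤ 2 ^ n * M * |shiftedRadius (t • e) u - 1| := by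
      refine intervalIntegral.norm_integral_le_of_norm_le_const fun r hr => ?_
      have hr2 : 0 ≤ r ∧ r ≤ 2 := by
        rcases Set.mem_uIoc.1 hr with h | h
        · exact ⟨by linarith, by linarith⟩
        · exact ⟨by linarith, by linarith⟩
      rw [hK, norm_mul, norm_pow, Real.norm_eq_abs, abs_of_nonneg hr2.1]
      refine mul_le_mul (pow_le_pow_left₀ hr2.1 hr2.2 _) (hM _ ?_) (norm_nonneg _) (by positivity)
      rw [mem_closedBall_zero_iff, norm_smul, hu, mul_one, Real.norm_eq_abs, abs_of_nonneg hr2.1]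
      linarith
    have hM0 : 0 ≤ M := (norm_nonneg _).trans (hM 0 (by simp))
    rw [norm_mul, norm_inv, Real.norm_eq_abs, abs_of_pos ht.1]
    calc t⁻¹ * _ ≤ t⁻¹ * (2 ^ n * M * (2 * ‖t • e‖)) :=
          mul_le_mul_of_nonneg_left (hb.trans (mul_le_mul_of_nonneg_left hd (by positivity)))
            (inv_nonneg.2 ht.1.le)
      _ = 2 ^ n * M * (2 * ‖e‖) := by
          have := ht.1.ne'
          rw [norm_smul, Real.norm_eq_abs, abs_of_pos ht.1]
          field_simp
  · refine Eventually.of_forall fun u => ?_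
    -- Only the upper endpoint depends on `t`, so continuity of `k` is enough for the derivative.
    have h1 : HasDerivAt (fun s => ∫ r in (0 : ℝ)..s, K u r) (K u 1)
        (shiftedRadius ((0 : ℝ) • e) u) := by
      rw [hr0]
      exact intervalIntegral.integral_hasDerivAt_right ((hKc u).intervalIntegrable _ _)
        ((hKc u).stronglyMeasurableAtFilter _ _) (hKc u).continuousAt
    have h2 := (h1.comp (0 : ℝ) (hasDerivAt_shiftedRadius e (u : E))).tendsto_slope_zero_right
    simp only [Function.comp_def, zero_add, hr0, smul_eq_mul] at h2
    simpa [hK] using h2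

/-- A convex function satisfies a subgradient inequality for the mean over the unit ball, the
subgradient being a surface integral. -/
lemma integral_toSphere_mul_inner_le_of_convexOn {k : E → ℝ} (hk : ConvexOn ℝ Set.univ k) (e : E) :
    ∫ u : sphere (0 : E) 1, k u * inner ℝ (u : E) e ∂ν.toSphere
      ≤ ∫ w in closedBall (0 : E) 1, k (w + e) ∂ν - ∫ w in closedBall (0 : E) 1, k w ∂ν := by
  have hc : Continuous k := hk.locallyLipschitz.continuous
  refine le_of_tendsto (tendsto_slope_setIntegral_closedBall ν hc e) ?_
  have hint : ∀ y : E, IntegrableOn (fun w => k (w + y)) (closedBall (0 : E) 1) ν := fun y =>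
    (Continuous.continuousOn (by fun_prop)).integrableOn_compact (isCompact_closedBall _ _)
  have hint0 : IntegrableOn k (closedBall (0 : E) 1) ν := by simpa using hint 0
  have h01 : Set.Ioo (0 : ℝ) 1 ∈ 𝓝[>] (0 : ℝ) := Ioo_mem_nhdsGT one_pos
  filter_upwards [h01] with t ht
  have hshift : ∫ w in closedBall (t • e) 1, k w ∂ν
      = ∫ w in closedBall (0 : E) 1, k (w + t • e) ∂ν := by
    rw [← (measurePreserving_add_right ν (t • e)).setIntegral_preimage_emb
      (measurableEmbedding_addRight _)]
    congr 2
    ext w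
    simp [dist_eq_norm]
  -- By convexity between `w` and `w + e`, every slope with `0 < t < 1` is already at most the full
  -- increment; the limit inherits this.
  have hconv : ∫ w in closedBall (0 : E) 1, k (w + t • e) ∂ν
      ≤ ∫ w in closedBall (0 : E) 1, ((1 - t) * k w + t * k (w + e)) ∂ν := by
    refine integral_mono (hint _) ((hint0.const_mul _).add ((hint e).const_mul _)) fun w => ?_
    have := hk.2 (Set.mem_univ w) (Set.mem_univ (w + e)) (sub_nonneg.2 ht.2.le) ht.1.le
      (sub_add_cancel 1 t)
    rw [show (1 - t) • w + t • (w + e) = w + t • e by module] at this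
    exact this
  rw [integral_add (hint0.const_mul _) ((hint e).const_mul _), integral_const_mul,
    integral_const_mul] at hconv
  rw [hshift, inv_mul_le_iff₀ ht.1]
  linarith

end Smoothing

/-! ### The gradient estimate as a mean subgradient -/

section SphereUniform

variable {d : ℕ}

lemma integral_sphereUniform (F : Vec d → ℝ) :
    ∫ u, F u ∂sphereUniform d
      = ((volume : Measure (Vec d)).toSphere.real Set.univ)⁻¹
        * ∫ u : Metric.sphere (0 : Vec d) 1, F u ∂(volume : Measure (Vec d)).toSphere := by
  rw [sphereUniform, integral_smul_measure, ENNReal.toReal_inv, smul_eq_mul,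
    (MeasurableEmbedding.subtype_coe Metric.isClosed_sphere.measurableSet).integral_map]
  rfl

lemma ae_norm_eq_one_sphereUniform : ∀ᵐ u ∂sphereUniform d, ‖u‖ = 1 := by
  refine Measure.ae_smul_measure ?_ _
  rw [ae_map_iff measurable_subtype_coe.aemeasurable
    (measurableSet_eq_fun (by fun_prop) (by fun_prop))]
  exact Filter.Eventually.of_forall fun u => norm_eq_of_mem_sphere u

/-- In dimension zero the sphere is empty, so `u t` could not have this law; the main theorem thus
obtains `0 < d`. -/
lemma sphereUniform_zero : sphereUniform 0 = 0 := by
  have : (volume : Measure (Vec 0)).toSphere = 0 :=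
    (Measure.toSphere_eq_zero_iff _).2 inferInstance
  rw [sphereUniform, this, Measure.map_zero, smul_zero]

/-- The zeroth-order gradient estimate is, on average, a subgradient of the smoothed function. -/
lemma integral_inner_zoGrad_le_smoothing_sub (hd : 0 < d) {μ : ℝ} (hμ : 0 < μ) {h : Vec d → ℝ}
    (hh : ConvexOn ℝ Set.univ h) (x y : Vec d) :
    ∫ u, inner ℝ (zoGrad μ h u x) (y - x) ∂sphereUniform d
      ≤ smoothing μ h y - smoothing μ h x := by
  have : Nonempty (Fin d) := ⟨⟨0, hd⟩⟩
  have : Nontrivial (Vec d) := inferInstance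
  have hd0 : (0 : ℝ) < d := by exact_mod_cast hd
  -- Rescaling to the unit ball: `x + μ • (w + e) = y + μ • w`.
  set k : Vec d → ℝ := fun w => h (x + μ • w) - h x with hk
  set e : Vec d := μ⁻¹ • (y - x) with he
  have hhc : Continuous h := hh.locallyLipschitz.continuous
  have hkconv : ConvexOn ℝ Set.univ k := by
    have h1 := hh.comp_affineMap
      ((AffineMap.const ℝ (Vec d) x) + (μ • LinearMap.id : Vec d →ₗ[ℝ] Vec d).toAffineMap)
    have h2 := h1.add (convexOn_const (-h x) convex_univ)
    exact h2
  have hmain := integral_toSphere_mul_inner_le_of_convexOn (volume : Measure (Vec d)) hkconv e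
  set B := Metric.closedBall (0 : Vec d) 1 with hB
  have hint : ∀ z : Vec d, IntegrableOn (fun w => h (z + μ • w)) B := fun z =>
    (Continuous.continuousOn (by fun_prop)).integrableOn_compact (isCompact_closedBall _ _)
  have hsub : (∫ w in B, k (w + e)) - ∫ w in B, k w
      = (∫ w in B, h (y + μ • w)) - ∫ w in B, h (x + μ • w) := by
    have hye : ∀ w, k (w + e) = h (y + μ • w) - h x := by
      intro w
      simp only [hk, he, smul_add, smul_smul, mul_inv_cancel₀ hμ.ne', one_smul]
      congr 2
      abel
    have hc : IntegrableOn (fun _ : Vec d => h x) B :=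
      continuousOn_const.integrableOn_compact (isCompact_closedBall _ _)
    simp only [hye]
    simp only [hk]
    rw [integral_sub (hint y) hc, integral_sub (hint x) hc]
    ring
  rw [hsub] at hmain
  -- The sphere has `d` times the mass of the ball; this cancels the factor `d` in `zoGrad`.
  have hreal : (volume : Measure (Vec d)).toSphere.real Set.univ
      = d * (volume : Measure (Vec d)).real B := by
    rw [Measure.toSphere_real_apply_univ, finrank_euclideanSpace_fin, measureReal_def,
      measureReal_def, hB, Measure.addHaar_closedBall_eq_addHaar_ball]
  have hBpos : 0 < (volume : Measure (Vec d)).real B :=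
    ENNReal.toReal_pos (Metric.measure_closedBall_pos _ _ one_pos).ne'
      measure_closedBall_lt_top.ne
  have hinner : ∀ u : Vec d, inner ℝ (zoGrad μ h u x) (y - x) = d * (k u * inner ℝ u e) := by
    intro u
    simp only [zoGrad, hk, he, real_inner_smul_left, real_inner_smul_right]
    ring
  simp only [hinner]
  rw [integral_sphereUniform, integral_const_mul, hreal, smoothing, smoothing, setAverage_eq,
    setAverage_eq, smul_eq_mul, smul_eq_mul, ← mul_sub, ← hB]
  refine le_trans (le_of_eq ?_) (mul_le_mul_of_nonneg_left hmain (inv_nonneg.2 hBpos.le))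
  field_simp

end SphereUniform

/-! ### Bounds that yield integrability -/

section Bounds

variable {d : ℕ}

/-- A bound for a convex function on the ball of radius `R`, from finitely many of its values. -/
def vertexBound (R : ℝ) (h : Vec d → ℝ) : ℝ :=
  2 * |h 0| + ∑ i : Fin d, (|h (-(d * R) • EuclideanSpace.single i 1)|
    + |h ((d * R) • EuclideanSpace.single i 1)|)

/-- Above: `y` is the average of the points `d * y i` on the axes, each between two vertices `±d *
R` of a cross-polytope. Below: `2 * h 0 ≤ h y + h (-y)` by convexity. -/
lemma abs_le_vertexBound (hd : 0 < d) {h : Vec d → ℝ} (hh : ConvexOn ℝ Set.univ h) {R : ℝ}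
    {y : Vec d} (hy : ‖y‖ ≤ R) : |h y| ≤ vertexBound R h := by
  have hd0 : (0 : ℝ) < d := by exact_mod_cast hd
  set S := ∑ i : Fin d, (|h (-(d * R) • EuclideanSpace.single i 1)|
    + |h ((d * R) • EuclideanSpace.single i 1)|) with hS
  have hupper : ∀ z : Vec d, ‖z‖ ≤ R → h z ≤ S := by
    intro z hz
    have hR : 0 ≤ R := (norm_nonneg z).trans hz
    have hzsum : z = ∑ i : Fin d, (1 / d : ℝ) • ((d * z i) • EuclideanSpace.single i (1 : ℝ)) := by
      ext j
      simp only [WithLp.ofLp_sum, Finset.sum_apply, PiLp.smul_apply, PiLp.single_apply,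
        smul_eq_mul]
      simp
      field_simp
    have hJ : h z ≤ ∑ i : Fin d, (1 / d : ℝ) • h ((d * z i) • EuclideanSpace.single i (1 : ℝ)) := by
      conv_lhs => rw [hzsum]
      exact hh.map_sum_le (fun _ _ => by positivity)
        (by rw [Finset.sum_const, Finset.card_univ, Fintype.card_fin, nsmul_eq_mul]; field_simp)
        (fun _ _ => Set.mem_univ _)
    refine hJ.trans (Finset.sum_le_sum fun i _ => ?_)
    have hzi : |z i| ≤ R := (PiLp.norm_apply_le z i).trans hz
    have hconv : ConvexOn ℝ Set.univ (fun t : ℝ => h (t • EuclideanSpace.single i (1 : ℝ))) :=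
      hh.comp_linearMap (LinearMap.toSpanSingleton ℝ (Vec d) (EuclideanSpace.single i (1 : ℝ)))
    have hmax := hconv.le_max_of_mem_Icc (x := -(d * R)) (y := d * R) (z := d * z i)
      (Set.mem_univ _) (Set.mem_univ _)
      ⟨by nlinarith [(abs_le.1 hzi).1], by nlinarith [(abs_le.1 hzi).2]⟩
    set a := h (-(d * R) • EuclideanSpace.single i 1)
    set b := h ((d * R) • EuclideanSpace.single i 1)
    have h3 : h ((d * z i) • EuclideanSpace.single i (1 : ℝ)) ≤ |a| + |b| :=
      hmax.trans (max_le (by linarith [le_abs_self a, abs_nonneg b])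
        (by linarith [le_abs_self b, abs_nonneg a]))
    have hd1 : (1 / d : ℝ) ≤ 1 := by
      rw [div_le_one hd0]
      exact_mod_cast hd
    rw [smul_eq_mul]
    calc (1 / d : ℝ) * h ((d * z i) • EuclideanSpace.single i (1 : ℝ))
        ≤ (1 / d : ℝ) * _ := mul_le_mul_of_nonneg_left h3 (by positivity)
      _ ≤ 1 * _ := mul_le_mul_of_nonneg_right hd1 (by positivity)
      _ = _ := one_mul _
  have h1 := hupper y hy
  have h2 := hupper (-y) (by rwa [norm_neg])
  have h3 := hh.2 (Set.mem_univ y) (Set.mem_univ (-y)) (by norm_num : (0 : ℝ) ≤ 1 / 2)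
    (by norm_num : (0 : ℝ) ≤ 1 / 2) (by norm_num)
  rw [smul_neg, add_neg_cancel, smul_eq_mul, smul_eq_mul] at h3
  have h4 := neg_abs_le (h 0)
  have h5 := abs_nonneg (h 0)
  rw [vertexBound, ← hS, abs_le]
  constructor <;> linarith

lemma abs_smoothing_le {h : Vec d → ℝ} {μ M : ℝ} (hμ : 0 ≤ μ) {x : Vec d}
    (hM : ∀ y, ‖y - x‖ ≤ μ → |h y| ≤ M) : |smoothing μ h x| ≤ M := by
  have hBpos : 0 < (volume : Measure (Vec d)).real (Metric.closedBall 0 1) :=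
    ENNReal.toReal_pos (Metric.measure_closedBall_pos _ _ one_pos).ne'
      measure_closedBall_lt_top.ne
  rw [smoothing, setAverage_eq, smul_eq_mul, abs_mul, abs_inv, abs_of_pos hBpos,
    inv_mul_le_iff₀ hBpos, mul_comm]
  refine norm_setIntegral_le_of_norm_le_const measure_closedBall_lt_top 
    fun w hw => (Real.norm_eq_abs _).trans_le (hM _ ?_)
  rw [add_sub_cancel_left, norm_smul, Real.norm_eq_abs, abs_of_nonneg hμ]
  exact mul_le_of_le_one_right hμ (mem_closedBall_zero_iff.1 hw)

lemma norm_zoGrad_le {h : Vec d → ℝ} {μ M : ℝ} (hμ : 0 < μ) {u x : Vec d} (hu : ‖u‖ = 1)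
    (hM : ∀ y, ‖y - x‖ ≤ μ → |h y| ≤ M) : ‖zoGrad μ h u x‖ ≤ d / μ * (2 * M) := by
  have h1 := hM x (by simpa using hμ.le)
  have h2 := hM (x + μ • u) (by simp [norm_smul, hu, abs_of_pos hμ])
  rw [zoGrad, norm_smul, hu, mul_one, Real.norm_eq_abs, abs_mul, abs_of_nonneg (by positivity)]
  refine mul_le_mul_of_nonneg_left ?_ (by positivity)
  have := abs_sub (h (x + μ • u)) (h x)
  linarith

/-- Only first moments of `g` are available, so the root of the second moment has to be bounded
linearly in the `|g s i|`. -/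
lemma secondMoment_le_sq_sum {β₂ : ℝ} (hβ₂ : β₂ ∈ Set.Ico (0 : ℝ) 1) (g : ℕ → Vec d) (t : ℕ)
    (i : Fin d) : secondMoment β₂ g t i ≤ (∑ s ∈ Finset.Icc 1 t, |g s i|) ^ 2 := by
  induction t with
  | zero => simp [secondMoment]
  | succ n ih =>
    rw [Finset.sum_Icc_succ_top (by omega), secondMoment]
    have hS : 0 ≤ ∑ s ∈ Finset.Icc 1 n, |g s i| := Finset.sum_nonneg fun _ _ => abs_nonneg _
    set S := ∑ s ∈ Finset.Icc 1 n, |g s i|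
    have h1 := mul_le_mul_of_nonneg_left ih hβ₂.1
    have h2 := mul_nonneg (sub_nonneg.2 hβ₂.2.le) (sq_nonneg S)
    have h3 := mul_nonneg hβ₂.1 (sq_nonneg (g (n + 1) i))
    have h4 := mul_nonneg hS (abs_nonneg (g (n + 1) i))
    have h5 := sq_abs (g (n + 1) i)
    nlinarith

lemma sqrt_maxSecondMoment_le {β₂ : ℝ} (hβ₂ : β₂ ∈ Set.Ico (0 : ℝ) 1) (vhat₀ : Fin d → ℝ)
    (g : ℕ → Vec d) (t : ℕ) (i : Fin d) :
    √(maxSecondMoment β₂ vhat₀ g t i) ≤ √(vhat₀ i) + ∑ s ∈ Finset.Icc 1 t, |g s i| := by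
  induction t with
  | zero => simp [maxSecondMoment]
  | succ n ih =>
    simp only [maxSecondMoment]
    rcases le_total (maxSecondMoment β₂ vhat₀ g n i) (secondMoment β₂ g (n + 1) i) with h | h
    · rw [max_eq_right h]
      refine (Real.sqrt_le_sqrt (secondMoment_le_sq_sum hβ₂ g (n + 1) i)).trans ?_
      rw [Real.sqrt_sq (Finset.sum_nonneg fun _ _ => abs_nonneg _)]
      exact le_add_of_nonneg_left (Real.sqrt_nonneg _)
    · rw [max_eq_left h, Finset.sum_Icc_succ_top (by omega)]
      linarith [abs_nonneg (g (n + 1) i)]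

end Bounds

/-! ### Measurability -/

section Measurability

variable {d : ℕ} {Ω Ξ : Type*} [MeasurableSpace Ω] [MeasurableSpace Ξ]

/-- Convexity on the whole space gives continuity in the point, so `f` is a Carathéodory function.
-/
lemma measurable_uncurry_of_convexOn {f : Vec d → Ξ → ℝ} (hfmeas : ∀ y, Measurable (f y))
    (hfconvex : ∀ s, ConvexOn ℝ Set.univ fun y => f y s) :
    Measurable (fun p : Vec d × Ξ => f p.1 p.2) :=
  measurable_uncurry_of_continuous_of_measurable
    (fun s => (hfconvex s).locallyLipschitz.continuous) hfmeas

lemma measurable_smoothing {f : Vec d → Ξ → ℝ}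
    (hf : Measurable (fun p : Vec d × Ξ => f p.1 p.2)) (μ : ℝ) :
    Measurable (fun p : Ξ × Vec d => smoothing μ (fun y => f y p.1) p.2) := by
  simp only [smoothing, setAverage_eq, smul_eq_mul]
  refine Measurable.const_mul ?_ _
  refine (StronglyMeasurable.integral_prod_right'
    (f := fun q : (Ξ × Vec d) × Vec d => f (q.1.2 + μ • q.2) q.1.1) ?_).measurable
  exact (hf.comp (by fun_prop : Measurable fun q : (Ξ × Vec d) × Vec d =>
    (q.1.2 + μ • q.2, q.1.1))).stronglyMeasurable

lemma measurable_zoGrad {f : Vec d → Ξ → ℝ}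
    (hf : Measurable (fun p : Vec d × Ξ => f p.1 p.2)) (μ : ℝ) :
    Measurable (fun p : (Ξ × Vec d) × Vec d => zoGrad μ (fun y => f y p.1.1) p.2 p.1.2) := by
  have h1 := hf.comp (by fun_prop : Measurable fun q : (Ξ × Vec d) × Vec d =>
    (q.1.2 + μ • q.2, q.1.1))
  have h2 := hf.comp (by fun_prop : Measurable fun q : (Ξ × Vec d) × Vec d => (q.1.2, q.1.1))
  exact ((h1.sub h2).const_mul _).smul measurable_snd

lemma measurable_secondMoment {g : Ω → ℕ → Vec d} (hg : ∀ t, 1 ≤ t → Measurable fun ω => g ω t)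
    (β₂ : ℝ) (t : ℕ) (i : Fin d) : Measurable fun ω => secondMoment β₂ (g ω) t i := by
  induction t with
  | zero => exact measurable_const
  | succ n ih =>
    have := hg (n + 1) (by omega)
    simp only [secondMoment]
    fun_prop

lemma measurable_maxSecondMoment {g : Ω → ℕ → Vec d} 
    (hg : ∀ t, 1 ≤ t → Measurable fun ω => g ω t) (β₂ : ℝ) (vhat₀ : Fin d → ℝ) (t : ℕ) (i : Fin d) :
    Measurable fun ω => maxSecondMoment β₂ vhat₀ (g ω) t i := by
  induction t with
  | zero => exact measurable_const
  | succ n ih => exact ih.max (measurable_secondMoment hg β₂ (n + 1) i)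

end Measurability

/-! ### Independence and averaging over the direction -/

section Independence

variable {Ω : Type*} [MeasurableSpace Ω] {P : Measure Ω} [IsProbabilityMeasure P]

/-- The joint law is a triple product, which is reassociated. -/
lemma indepFun_prodMk_left_of_prodMk_right {α β δ : Type*} [MeasurableSpace α]
    [MeasurableSpace β] [MeasurableSpace δ] {W : Ω → α} {A : Ω → β} {C : Ω → δ}
    (hW : Measurable W) (hA : Measurable A) (hC : Measurable C)
    (h : IndepFun W (fun ω => (A ω, C ω)) P) (hAC : IndepFun A C P) :
    IndepFun (fun ω => (W ω, A ω)) C P := by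
  have := Measure.isProbabilityMeasure_map (μ := P) hW.aemeasurable
  have := Measure.isProbabilityMeasure_map (μ := P) hA.aemeasurable
  have := Measure.isProbabilityMeasure_map (μ := P) hC.aemeasurable
  have hWA : IndepFun W A P := h.comp measurable_id measurable_fst
  rw [indepFun_iff_map_prod_eq_prod_map_map (by fun_prop) (by fun_prop)] at h hAC hWA ⊢
  rw [hWA]
  rw [hAC] at h
  have h2 := congrArg (Measure.map MeasurableEquiv.prodAssoc.symm) h
  rw [Measure.map_map (by fun_prop) (by fun_prop)] at h2
  have h3 := (measurePreserving_prodAssoc (P.map W) (P.map A) (P.map C)).symm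
  rw [h3.map_eq] at h2
  exact h2

variable {d : ℕ} {Ξ : Type*} [MeasurableSpace Ξ]

/-- The direction of a round is independent of the samples and of the preceding directions. -/
lemma indepFun_direction {ξ : ℕ → Ω → Ξ} (hξ : ∀ t, Measurable (ξ t)) {u : ℕ → Ω → Vec d}
    (hu : ∀ t, Measurable (u t)) (huindep : iIndepFun u P)
    (hξu : IndepFun (fun ω t => ξ t ω) (fun ω t => u t ω) P)
    {x : Ω → Vec d} {t : ℕ} (hx : Measurable[history ξ u t] x)
    {xstar : (ℕ → Ξ) → Vec d} (hxstar : Measurable xstar) :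
    IndepFun (fun ω => ((ξ t ω, x ω), xstar fun s => ξ s ω)) (u t) P := by
  have hW : Measurable (fun ω s => ξ s ω) := measurable_pi_lambda _ hξ
  set A : Ω → (Finset.Ico 1 t → Vec d) := fun ω s => u s ω with hA
  have hAm : Measurable A := measurable_pi_lambda _ fun s => hu s
  have hAC : IndepFun A (u t) P := by
    have h := huindep.indepFun_finset (Finset.Ico 1 t) {t} (by simp) hu
    exact h.comp measurable_id (measurable_pi_apply (⟨t, by simp⟩ : ({t} : Finset ℕ)))
  have hWAC : IndepFun (fun ω s => ξ s ω) (fun ω => (A ω, u t ω)) P :=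
    hξu.comp measurable_id (ψ := fun v : ℕ → Vec d => ((fun s : Finset.Ico 1 t => v s), v t))
      (by fun_prop)
  have hind := indepFun_prodMk_left_of_prodMk_right hW hAm (hu t) hWAC hAC
  rw [IndepFun_iff_Indep] at hind ⊢
  refine indep_of_indep_of_le_left hind (Measurable.comap_le ?_)
  -- `𝓖` contains all samples, future ones included, and the directions before round `t`. Hence both
  -- `x t` and the sample-dependent comparator are `𝓖`-measurable.
  set 𝓖 := MeasurableSpace.comap (fun ω => ((fun s => ξ s ω), A ω)) inferInstance with h𝓖
  have hpair : Measurable[𝓖] (fun ω => ((fun s => ξ s ω), A ω)) := comap_measurable _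
  have hW' : Measurable[𝓖] (fun ω s => ξ s ω) := measurable_fst.comp hpair
  have hξ' : ∀ s, Measurable[𝓖] (ξ s) := fun s => (measurable_pi_apply s).comp hW'
  have hu' : ∀ s ∈ Set.Ico 1 t, Measurable[𝓖] (u s) := fun s hs =>
    (measurable_pi_apply (⟨s, by simpa using hs⟩ : Finset.Ico 1 t)).comp
      (measurable_snd.comp hpair)
  have hx' : Measurable[𝓖] x := hx.mono
    (iSup₂_le fun s hs => sup_le (hξ' s).comap_le (hu' s hs).comap_le) le_rfl
  exact ((hξ' t).prodMk hx').prodMk (hxstar.comp hW')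

/-- The zeroth-order gradient estimate along an independent uniform direction is, on average, a
subgradient of the smoothed loss. -/
lemma integral_smoothing_sub_le (hd : 0 < d) {μ : ℝ} (hμ : 0 < μ) {f : Vec d → Ξ → ℝ}
    (hf : Measurable (fun p : Vec d × Ξ => f p.1 p.2))
    (hfconvex : ∀ s, ConvexOn ℝ Set.univ fun y => f y s)
    {ζ : Ω → Ξ} {x y U : Ω → Vec d} (hζ : Measurable ζ) (hx : Measurable x) (hy : Measurable y)
    (hU : Measurable U) (hlaw : P.map U = sphereUniform d)
    (hind : IndepFun (fun ω => ((ζ ω, x ω), y ω)) U P)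
    (hint : Integrable
      (fun ω => inner ℝ (zoGrad μ (fun z => f z (ζ ω)) (U ω) (x ω)) (y ω - x ω)) P)
    (hintx : Integrable (fun ω => smoothing μ (fun z => f z (ζ ω)) (x ω)) P)
    (hinty : Integrable (fun ω => smoothing μ (fun z => f z (ζ ω)) (y ω)) P) :
    ∫ ω, inner ℝ (zoGrad μ (fun z => f z (ζ ω)) (U ω) (x ω)) (y ω - x ω) ∂P
      ≤ ∫ ω, smoothing μ (fun z => f z (ζ ω)) (y ω) ∂P
        - ∫ ω, smoothing μ (fun z => f z (ζ ω)) (x ω) ∂P := by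
  set Z : Ω → (Ξ × Vec d) × Vec d := fun ω => ((ζ ω, x ω), y ω) with hZ
  have hZm : Measurable Z := by fun_prop
  set H : ((Ξ × Vec d) × Vec d) × Vec d → ℝ := fun p =>
    inner ℝ (zoGrad μ (fun z => f z p.1.1.1) p.2 p.1.1.2) (p.1.2 - p.1.1.2) with hH
  have hHm : Measurable H := by
    have h1 := (measurable_zoGrad hf μ).comp
      (by fun_prop : Measurable fun p : ((Ξ × Vec d) × Vec d) × Vec d => (p.1.1, p.2))
    exact h1.inner (by fun_prop)
  set S : (Ξ × Vec d) × Vec d → ℝ := fun p =>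
    smoothing μ (fun z => f z p.1.1) p.2 - smoothing μ (fun z => f z p.1.1) p.1.2 with hS
  have hSm : Measurable S :=
    ((measurable_smoothing hf μ).comp (by fun_prop : Measurable
      fun p : (Ξ × Vec d) × Vec d => (p.1.1, p.2))).sub
    ((measurable_smoothing hf μ).comp (by fun_prop : Measurable
      fun p : (Ξ × Vec d) × Vec d => (p.1.1, p.1.2)))
  have := Measure.isProbabilityMeasure_map (μ := P) hZm.aemeasurable
  have : IsProbabilityMeasure (sphereUniform d) :=
    hlaw ▸ Measure.isProbabilityMeasure_map (μ := P) hU.aemeasurable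
  -- Independence makes the joint law a product, so the direction is integrated first, with
  -- everything else frozen.
  have hprod : P.map (fun ω => (Z ω, U ω)) = (P.map Z).prod (sphereUniform d) := by
    rw [← hlaw]
    exact (indepFun_iff_map_prod_eq_prod_map_map hZm.aemeasurable hU.aemeasurable).1 hind
  have hHint : Integrable H ((P.map Z).prod (sphereUniform d)) := by
    rw [← hprod]
    exact (integrable_map_measure hHm.aestronglyMeasurable (by fun_prop)).2 hint
  have hSint : Integrable S (P.map Z) :=
    (integrable_map_measure hSm.aestronglyMeasurable hZm.aemeasurable).2 (hinty.sub hintx)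
  have hHle : ∀ z, ∫ v, H (z, v) ∂(sphereUniform d) ≤ S z := fun z =>
    integral_inner_zoGrad_le_smoothing_sub hd hμ (hfconvex z.1.1) z.1.2 z.2
  have hmono : ∫ z, ∫ v, H (z, v) ∂(sphereUniform d) ∂(P.map Z) ≤ ∫ z, S z ∂(P.map Z) :=
    integral_mono hHint.integral_prod_left hSint hHle
  rw [← integral_prod _ hHint, ← hprod, integral_map (by fun_prop) hHm.aestronglyMeasurable,
    integral_map hZm.aemeasurable hSm.aestronglyMeasurable] at hmono
  rw [← integral_sub hinty hintx]
  exact hmono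

end Independence

variable {d : ℕ}

lemma exists_norm_le_of_abs_sub_le {X : Set (Vec d)} {D : ℝ}
    (hD : ∀ y ∈ X, ∀ z ∈ X, ∀ i, |y i - z i| ≤ D) {x₁ : Vec d} (hx₁ : x₁ ∈ X) :
    ∃ R, ∀ y ∈ X, ‖y‖ ≤ R := by
  refine ⟨√(∑ i, (|x₁ i| + D) ^ 2), fun y hy => ?_⟩
  rw [EuclideanSpace.norm_eq]
  refine Real.sqrt_le_sqrt (Finset.sum_le_sum fun i _ => pow_le_pow_left₀ (norm_nonneg _) ?_ 2)
  have h1 := hD y hy x₁ hx₁ i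
  have h2 := abs_sub_abs_le_abs_sub (y i) (x₁ i)
  rw [Real.norm_eq_abs]
  linarith

lemma integrable_vertexBound {Ω Ξ : Type*} [MeasurableSpace Ω] {P : Measure Ω}
    {f : Vec d → Ξ → ℝ} {ζ : Ω → Ξ} (hf : ∀ y, Integrable (fun ω => f y (ζ ω)) P) (R : ℝ) :
    Integrable (fun ω => vertexBound R (fun y => f y (ζ ω))) P := by
  simp only [vertexBound]
  exact ((hf _).abs.const_mul _).add
    (integrable_finsetSum _ fun i _ => (hf _).abs.add (hf _).abs)

lemma measurable_coord {Ω : Type*} [MeasurableSpace Ω] {a : Ω → Vec d} (ha : Measurable a)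
    (i : Fin d) : Measurable fun ω => a ω i := by
  fun_prop

end ZOAdaMM

end

/-! ### The main theorem -/

open ZOAdaMM

set_option maxHeartbeats 4000000 in
theorem proposition4 {Ω Ξ : Type*} [MeasurableSpace Ω] [MeasurableSpace Ξ]
    (P : Measure Ω) [IsProbabilityMeasure P] {d : ℕ}
    -- the feasible set, closed and convex, of diameter at most `D` in the sup norm
    (X : Set (ZOAdaMM.Vec d)) (hXclosed : IsClosed X) (hXconvex : Convex ℝ X)
    (D : ℝ) (hD : ∀ y ∈ X, ∀ z ∈ X, ∀ i, |y i - z i| ≤ D)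
    -- the losses `f(·; ξ)`, convex on `ℝ^d`, and the random samples `ξ_t`
    (f : ZOAdaMM.Vec d → Ξ → ℝ)
    (hfmeas : ∀ y, Measurable (f y))
    (hfconvex : ∀ s, ConvexOn ℝ Set.univ fun y => f y s)
    (ξ : ℕ → Ω → Ξ) (hξmeas : ∀ t, Measurable (ξ t))
    (hfint : ∀ t y, Integrable (fun ω => f y (ξ t ω)) P)
    -- the random directions: i.i.d., uniform on the unit sphere, independent of the samples
    (u : ℕ → Ω → ZOAdaMM.Vec d) (humeas : ∀ t, Measurable (u t))
    (hulaw : ∀ t, P.map (u t) = ZOAdaMM.sphereUniform d)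
    (huindep : iIndepFun u P)
    (hξu : IndepFun (fun ω t => ξ t ω) (fun ω t => u t ω) P)
    -- the parameters of the algorithm
    (μ α β₁ β₂ γ : ℝ) (hμ : 0 < μ) (hα : 0 < α)
    (hβ₁ : β₁ ∈ Set.Ico (0 : ℝ) 1) (hβ₂ : β₂ ∈ Set.Ico (0 : ℝ) 1)
    (hβ : β₂ = 0 → β₁ = 0) (hγ : γ = β₁ / √β₂) (hγ1 : γ < 1)
    (x₁ : ZOAdaMM.Vec d) (hx₁ : x₁ ∈ X) (vhat₀ : Fin d → ℝ) (hvhat₀ : ∀ i, 0 ≤ vhat₀ i)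
    -- the iterates, for `α_t = α / √t` and `β_{1,t} = β₁ / t`
    (x : ℕ → Ω → ZOAdaMM.Vec d)
    (hx : ZOAdaMM.IsRun X f μ (fun t => α / √(t : ℝ)) (fun t => β₁ / (t : ℝ)) β₂
      x₁ vhat₀ ξ u x)
    -- the comparator: a feasible point, possibly depending on the samples
    (xstar : (ℕ → Ξ) → ZOAdaMM.Vec d) (hxstar_meas : Measurable xstar)
    (hxstar : ∀ s, xstar s ∈ X)
    (T : ℕ) (hT : 1 ≤ T)
    -- smoothed losses, estimates `ĝ_t`, and vectors `v̂_t`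
    (fs : ℕ → Ω → ZOAdaMM.Vec d → ℝ)
    (hfs : ∀ t ω, fs t ω = ZOAdaMM.smoothing μ fun y => f y (ξ t ω))
    (g : Ω → ℕ → ZOAdaMM.Vec d) (hg : g = ZOAdaMM.ghat f μ ξ u x)
    (vhat : Ω → ℕ → Fin d → ℝ)
    (hvhat : ∀ ω, vhat ω = ZOAdaMM.maxSecondMoment β₂ vhat₀ (g ω)) :
    -- all the expectations below are finite
    (∀ t ∈ Finset.Icc 1 T, Integrable (fun ω => fs t ω (x t ω)) P) ∧
    (∀ t ∈ Finset.Icc 1 T, Integrable (fun ω => fs t ω (xstar fun s => ξ s ω)) P) ∧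
    (∀ t ∈ Finset.Icc 1 T, ∀ i, Integrable (fun ω => √(vhat ω t i)) P) ∧
    (∀ i, Integrable (fun ω => √(∑ t ∈ Finset.Icc 1 T, g ω t i ^ 2)) P) ∧
    -- the bound on the average regret
    ∫ ω, ((1 / (T : ℝ)) * ∑ t ∈ Finset.Icc 1 T, fs t ω (x t ω)
          - (1 / (T : ℝ)) * ∑ t ∈ Finset.Icc 1 T, fs t ω (xstar fun s => ξ s ω)) ∂P
      ≤ D ^ 2 * (∑ i, ∫ ω, √(vhat ω T i) ∂P) / (α * (1 - β₁) * √(T : ℝ))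
        + D ^ 2 / (2 * (1 - β₁) * (T : ℝ)) *
            ∑ t ∈ Finset.Icc 1 T, ∑ i, β₁ * (∫ ω, √(vhat ω t i) ∂P) / (α * √(t : ℝ))
        + α * √(1 + Real.log (T : ℝ)) *
            (∑ i, ∫ ω, √(∑ t ∈ Finset.Icc 1 T, g ω t i ^ 2) ∂P)
          / ((1 - β₁) ^ 2 * (1 - γ) * √(1 - β₂) * (T : ℝ)) := by
  have hd : 0 < d := by
    rcases Nat.eq_zero_or_pos d with rfl | h
    · have := Measure.isProbabilityMeasure_map (μ := P) (humeas 0).aemeasurable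
      rw [hulaw 0, sphereUniform_zero] at this
      exact absurd rfl (IsProbabilityMeasure.ne_zero (0 : Measure (Vec 0)))
    · exact h
  have hvhat' : ∀ ω t i, vhat ω t i = maxSecondMoment β₂ vhat₀ (g ω) t i := fun ω t i => by
    rw [hvhat]
  obtain ⟨R, hR⟩ := exists_norm_le_of_abs_sub_le hD hx₁
  have hfm := measurable_uncurry_of_convexOn hfmeas hfconvex
  have hxX : ∀ t, 1 ≤ t → ∀ ω, x t ω ∈ X := by
    intro t ht ω
    induction t, ht using Nat.le_induction with
    | base => rw [hx.init]; exact hx₁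
    | succ n hn _ => exact (hx.step n hn ω).1
  have hhist : ∀ t, history ξ u t ≤ (inferInstance : MeasurableSpace Ω) := fun t =>
    iSup₂_le fun s _ => sup_le (hξmeas s).comap_le (humeas s).comap_le
  have hxmeas : ∀ t, 1 ≤ t → Measurable (x t) := fun t ht =>
    (hx.adapted t ht).mono (hhist t) le_rfl
  have hsm : Measurable (fun ω => xstar fun s => ξ s ω) :=
    hxstar_meas.comp (measurable_pi_lambda _ hξmeas)
  set xs : Ω → Vec d := fun ω => xstar fun s => ξ s ω with hxs
  have hxsX : ∀ ω, xs ω ∈ X := fun ω => hxstar _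
  -- a common integrable bound for the losses near the feasible set
  set N : ℕ → Ω → ℝ := fun t ω => vertexBound (R + μ) (fun y => f y (ξ t ω)) with hN
  have hNint : ∀ t, Integrable (N t) P := fun t => integrable_vertexBound (hfint t) _
  have hNle : ∀ t ω (z : Vec d), z ∈ X → ∀ y, ‖y - z‖ ≤ μ → |f y (ξ t ω)| ≤ N t ω := by
    intro t ω z hz y hy
    refine abs_le_vertexBound hd (hfconvex (ξ t ω)) ?_
    have := norm_add_le z (y - z)
    rw [add_sub_cancel] at this
    linarith [hR z hz]
  have hgapp : ∀ ω t, g ω t = zoGrad μ (fun y => f y (ξ t ω)) (u t ω) (x t ω) := fun ω t => by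
    rw [hg]; rfl
  have hgmeas : ∀ t, 1 ≤ t → Measurable fun ω => g ω t := fun t ht => by
    simp only [hgapp]
    exact (measurable_zoGrad hfm μ).comp
      (((hξmeas t).prodMk (hxmeas t ht)).prodMk (humeas t))
  have hu1 : ∀ t, ∀ᵐ ω ∂P, ‖u t ω‖ = 1 := fun t => by
    have h := ae_norm_eq_one_sphereUniform (d := d)
    rw [← hulaw t] at h
    exact ae_of_ae_map (humeas t).aemeasurable h
  have hgle : ∀ t, 1 ≤ t → ∀ᵐ ω ∂P, ‖g ω t‖ ≤ d / μ * (2 * N t ω) := fun t ht => by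
    filter_upwards [hu1 t] with ω hω
    rw [hgapp]
    exact norm_zoGrad_le hμ hω (hNle t ω _ (hxX t ht ω))
  have hgint : ∀ t, 1 ≤ t → Integrable (fun ω => g ω t) P := fun t ht =>
    (((hNint t).const_mul 2).const_mul (d / μ)).mono' (hgmeas t ht).aestronglyMeasurable (hgle t ht)
  have hgiint : ∀ t, 1 ≤ t → ∀ i, Integrable (fun ω => g ω t i) P := fun t ht i =>
    (hgint t ht).norm.mono' (measurable_coord (hgmeas t ht) i).aestronglyMeasurable
      (Filter.Eventually.of_forall fun ω => PiLp.norm_apply_le _ _)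
  have hsmint : ∀ t, ∀ z : Ω → Vec d, Measurable z → (∀ ω, z ω ∈ X) →
      Integrable (fun ω => smoothing μ (fun y => f y (ξ t ω)) (z ω)) P := fun t z hz hzX =>
    (hNint t).mono' ((measurable_smoothing hfm μ).comp
      ((hξmeas t).prodMk hz)).aestronglyMeasurable
      (Filter.Eventually.of_forall fun ω => abs_smoothing_le hμ.le (hNle t ω _ (hzX ω)))
  have hvmeas : ∀ t i, Measurable fun ω => vhat ω t i := fun t i => by
    simp only [hvhat']
    exact measurable_maxSecondMoment hgmeas _ _ _ _
  have hvint : ∀ t i, Integrable (fun ω => √(vhat ω t i)) P := by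
    intro t i
    refine ((integrable_const (√(vhat₀ i))).add (integrable_finsetSum (Finset.Icc 1 t)
      fun s hs => (hgiint s (Finset.mem_Icc.1 hs).1 i).abs)).mono'
      (hvmeas t i).sqrt.aestronglyMeasurable (Filter.Eventually.of_forall fun ω => ?_)
    rw [Real.norm_eq_abs, abs_of_nonneg (Real.sqrt_nonneg _), hvhat']
    exact sqrt_maxSecondMoment_le hβ₂ vhat₀ (g ω) t i
  have hrootint : ∀ i, Integrable (fun ω => √(∑ t ∈ Finset.Icc 1 T, g ω t i ^ 2)) P := by
    intro i
    refine (integrable_finsetSum (Finset.Icc 1 T)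
      fun s hs => (hgiint s (Finset.mem_Icc.1 hs).1 i).abs).mono' ?_
      (Filter.Eventually.of_forall fun ω => ?_)
    · exact (Finset.measurable_sum _ fun s hs =>
        (measurable_coord (hgmeas s (Finset.mem_Icc.1 hs).1) i).pow_const 2).sqrt.aestronglyMeasurable
    · rw [Real.norm_eq_abs, abs_of_nonneg (Real.sqrt_nonneg _)]
      refine Real.sqrt_le_iff.2 ⟨Finset.sum_nonneg fun _ _ => abs_nonneg _, ?_⟩
      simpa using Finset.sum_sq_le_sq_sum_of_nonneg (s := Finset.Icc 1 T)
        (f := fun t => |g ω t i|) fun _ _ => abs_nonneg _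
  have hI1 : ∀ t, 1 ≤ t → Integrable (fun ω => fs t ω (x t ω)) P := fun t ht => by
    simp only [hfs]
    exact hsmint t _ (hxmeas t ht) (hxX t ht)
  have hI2 : ∀ t, Integrable (fun ω => fs t ω (xs ω)) P := fun t => by
    simp only [hfs]
    exact hsmint t _ hsm hxsX
  refine ⟨fun t ht => hI1 t (Finset.mem_Icc.1 ht).1, fun t _ => hI2 t, fun t _ i => hvint t i,
    hrootint, ?_⟩
  have hβ1 : 0 < 1 - β₁ := by linarith [hβ₁.2]
  have hβ2 : 0 < √(1 - β₂) := Real.sqrt_pos.2 (by linarith [hβ₂.2])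
  have hγ1' : 0 < 1 - γ := by linarith
  have hT0 : (0 : ℝ) < T := by exact_mod_cast hT
  -- the linearized regret of a single round
  have hprodint : ∀ t, 1 ≤ t → ∀ i, Integrable (fun ω => g ω t i * (x t ω i - xs ω i)) P := by
    intro t ht i
    refine (hgiint t ht i).mul_bdd (c := D) ?_ ?_
    · exact ((measurable_coord (hxmeas t ht) i).sub (measurable_coord hsm i)).aestronglyMeasurable
    · exact Filter.Eventually.of_forall fun ω => hD _ (hxX t ht ω) _ (hxsX ω) i
  have hinner : ∀ t ω, inner ℝ (zoGrad μ (fun y => f y (ξ t ω)) (u t ω) (x t ω)) (xs ω - x t ω)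
      = -∑ i, g ω t i * (x t ω i - xs ω i) := by
    intro t ω
    rw [← hgapp, PiLp.inner_apply, ← Finset.sum_neg_distrib]
    refine Finset.sum_congr rfl fun i _ => ?_
    simp only [PiLp.sub_apply, RCLike.inner_apply, conj_trivial]
    ring
  have hround : ∀ t, 1 ≤ t → ∫ ω, fs t ω (x t ω) ∂P - ∫ ω, fs t ω (xs ω) ∂P
      ≤ ∫ ω, ∑ i, g ω t i * (x t ω i - xs ω i) ∂P := by
    intro t ht
    have hsumint : Integrable (fun ω => ∑ i, g ω t i * (x t ω i - xs ω i)) P :=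
      integrable_finsetSum _ fun i _ => hprodint t ht i
    have h := integral_smoothing_sub_le hd hμ hfm hfconvex (hξmeas t) (hxmeas t ht) hsm
      (humeas t) (hulaw t)
      (indepFun_direction hξmeas humeas huindep hξu (hx.adapted t ht) hxstar_meas)
      (by simp only [hinner]; exact hsumint.neg) (hsmint t _ (hxmeas t ht) (hxX t ht))
      (hsmint t _ hsm hxsX)
    change ∫ ω, inner ℝ (zoGrad μ (fun y => f y (ξ t ω)) (u t ω) (x t ω)) (xs ω - x t ω) ∂P
      ≤ _ at h
    simp only [hinner, integral_neg] at h
    simp only [hfs]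
    linarith
  -- the deterministic bound, integrated
  have hdet : ∫ ω, ∑ t ∈ Finset.Icc 1 T, ∑ i, g ω t i * (x t ω i - xs ω i) ∂P
      ≤ ∫ ω, ∑ i, (D ^ 2 * √(T : ℝ) * √(vhat ω T i) / (2 * α * (1 - β₁))
        + D ^ 2 / (2 * (1 - β₁)) * ∑ t ∈ Finset.Icc 1 T, β₁ * √(vhat ω t i) / (α * √(t : ℝ))
        + α * √(1 + Real.log T) * √(∑ t ∈ Finset.Icc 1 T, g ω t i ^ 2)
            / ((1 - β₁) * (1 - γ) * √(1 - β₂))) ∂P := by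
    refine integral_mono (integrable_finsetSum _ fun t ht => integrable_finsetSum _ fun i _ =>
      hprodint t (Finset.mem_Icc.1 ht).1 i) (integrable_finsetSum _ fun i _ =>
        ((((hvint T i).const_mul _).div_const _).add ((integrable_finsetSum _ fun t _ =>
          ((hvint t i).const_mul _).div_const _).const_mul _)).add
          (((hrootint i).const_mul _).div_const _)) fun ω => ?_
    have h := sum_inner_le_of_isMahalanobisProj hXconvex hD hα hβ₁ hβ₂ hβ hγ hγ1 hvhat₀
      (g := g ω) (x := fun t => x t ω) (by rw [hx.init]; exact hx₁)
      (fun t ht => by rw [hg]; exact hx.step t ht ω) (hxsX ω) hT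
    simpa only [hvhat'] using h
  set Ev : ℕ → Fin d → ℝ := fun t i => ∫ ω, √(vhat ω t i) ∂P with hEv
  set Eg : Fin d → ℝ := fun i => ∫ ω, √(∑ t ∈ Finset.Icc 1 T, g ω t i ^ 2) ∂P with hEg
  have hEv0 : ∀ t i, 0 ≤ Ev t i := fun t i => integral_nonneg fun _ => Real.sqrt_nonneg _
  have hEg0 : ∀ i, 0 ≤ Eg i := fun i => integral_nonneg fun _ => Real.sqrt_nonneg _
  have hcompute : ∫ ω, ∑ i, (D ^ 2 * √(T : ℝ) * √(vhat ω T i) / (2 * α * (1 - β₁))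
        + D ^ 2 / (2 * (1 - β₁)) * ∑ t ∈ Finset.Icc 1 T, β₁ * √(vhat ω t i) / (α * √(t : ℝ))
        + α * √(1 + Real.log T) * √(∑ t ∈ Finset.Icc 1 T, g ω t i ^ 2)
            / ((1 - β₁) * (1 - γ) * √(1 - β₂))) ∂P
      = D ^ 2 * √(T : ℝ) * (∑ i, Ev T i) / (2 * α * (1 - β₁))
        + D ^ 2 / (2 * (1 - β₁)) *
          ∑ t ∈ Finset.Icc 1 T, ∑ i, β₁ * Ev t i / (α * √(t : ℝ))
        + α * √(1 + Real.log T) * (∑ i, Eg i) / ((1 - β₁) * (1 - γ) * √(1 - β₂)) := by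
    have i1 : ∀ i, Integrable
        (fun ω => D ^ 2 * √(T : ℝ) * √(vhat ω T i) / (2 * α * (1 - β₁))) P := fun i =>
      ((hvint T i).const_mul _).div_const _
    have i2 : ∀ i, ∀ t ∈ Finset.Icc 1 T, Integrable
        (fun ω => β₁ * √(vhat ω t i) / (α * √(t : ℝ))) P := fun i t _ =>
      ((hvint t i).const_mul _).div_const _
    have i3 : ∀ i, Integrable (fun ω => D ^ 2 / (2 * (1 - β₁)) *
        ∑ t ∈ Finset.Icc 1 T, β₁ * √(vhat ω t i) / (α * √(t : ℝ))) P := fun i =>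
      (integrable_finsetSum _ (i2 i)).const_mul _
    have i4 : ∀ i, Integrable (fun ω => α * √(1 + Real.log T)
        * √(∑ t ∈ Finset.Icc 1 T, g ω t i ^ 2) / ((1 - β₁) * (1 - γ) * √(1 - β₂))) P := fun i =>
      ((hrootint i).const_mul _).div_const _
    have i5 : ∀ i ∈ Finset.univ, Integrable
        (fun ω => D ^ 2 * √(T : ℝ) * √(vhat ω T i) / (2 * α * (1 - β₁))
        + D ^ 2 / (2 * (1 - β₁)) * ∑ t ∈ Finset.Icc 1 T, β₁ * √(vhat ω t i) / (α * √(t : ℝ))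
        + α * √(1 + Real.log T) * √(∑ t ∈ Finset.Icc 1 T, g ω t i ^ 2)
            / ((1 - β₁) * (1 - γ) * √(1 - β₂))) P := fun i _ => ((i1 i).add (i3 i)).add (i4 i)
    have i6 : ∀ i, ∫ ω, (D ^ 2 * √(T : ℝ) * √(vhat ω T i) / (2 * α * (1 - β₁))
        + D ^ 2 / (2 * (1 - β₁)) * ∑ t ∈ Finset.Icc 1 T, β₁ * √(vhat ω t i) / (α * √(t : ℝ))
        + α * √(1 + Real.log T) * √(∑ t ∈ Finset.Icc 1 T, g ω t i ^ 2)
            / ((1 - β₁) * (1 - γ) * √(1 - β₂))) ∂P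
        = D ^ 2 * √(T : ℝ) * Ev T i / (2 * α * (1 - β₁))
          + D ^ 2 / (2 * (1 - β₁)) * ∑ t ∈ Finset.Icc 1 T, β₁ * Ev t i / (α * √(t : ℝ))
          + α * √(1 + Real.log T) * Eg i / ((1 - β₁) * (1 - γ) * √(1 - β₂)) := by
      intro i
      refine (integral_add ((i1 i).add (i3 i)) (i4 i)).trans ?_
      refine congrArg₂ (· + ·) ((integral_add (i1 i) (i3 i)).trans ?_) ?_
      · rw [integral_div, integral_const_mul, integral_const_mul, integral_finsetSum _ (i2 i)]
        simp only [integral_div, integral_const_mul, hEv]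
      · rw [integral_div, integral_const_mul]
    rw [integral_finsetSum _ i5]
    simp only [i6]
    rw [Finset.sum_comm (s := Finset.Icc 1 T)]
    simp only [Finset.sum_add_distrib, Finset.mul_sum, Finset.sum_div]
  have hregret : ∫ ω, ((1 / (T : ℝ)) * ∑ t ∈ Finset.Icc 1 T, fs t ω (x t ω)
          - (1 / (T : ℝ)) * ∑ t ∈ Finset.Icc 1 T, fs t ω (xs ω)) ∂P
      ≤ 1 / (T : ℝ) * ∫ ω, ∑ t ∈ Finset.Icc 1 T, ∑ i, g ω t i * (x t ω i - xs ω i) ∂P := by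
    have j1 : ∀ t ∈ Finset.Icc 1 T, Integrable (fun ω => fs t ω (x t ω)) P := fun t ht =>
      hI1 t (Finset.mem_Icc.1 ht).1
    rw [integral_sub ((integrable_finsetSum _ j1).const_mul _)
      ((integrable_finsetSum _ fun t _ => hI2 t).const_mul _), integral_const_mul,
      integral_const_mul, integral_finsetSum _ j1, integral_finsetSum _ fun t _ => hI2 t,
      ← mul_sub, ← Finset.sum_sub_distrib, integral_finsetSum _ fun t ht =>
        integrable_finsetSum _ fun i _ => hprodint t (Finset.mem_Icc.1 ht).1 i]
    exact mul_le_mul_of_nonneg_left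
      (Finset.sum_le_sum fun t ht => hround t (Finset.mem_Icc.1 ht).1) (by positivity)
  refine hregret.trans ((mul_le_mul_of_nonneg_left (hdet.trans_eq hcompute)
    (by positivity)).trans ?_)
  rw [mul_add, mul_add]
  -- The middle terms agree exactly; the first has a factor `1 / 2` to spare and the last a factor
  -- `1 - β₁`.
  refine add_le_add (add_le_add ?_ (le_of_eq ?_)) ?_
  · have hs : (T : ℝ) = √(T : ℝ) * √(T : ℝ) := (Real.mul_self_sqrt hT0.le).symm
    have hs0 : 0 < √(T : ℝ) := Real.sqrt_pos.2 hT0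
    have hSE : 0 ≤ ∑ i, Ev T i := Finset.sum_nonneg fun i _ => hEv0 T i
    have e : 1 / (T : ℝ) * (D ^ 2 * √(T : ℝ) * (∑ i, Ev T i) / (2 * α * (1 - β₁)))
        = D ^ 2 * (∑ i, Ev T i) / (α * (1 - β₁) * √(T : ℝ)) / 2 := by
      have h1 : 1 / (T : ℝ) = 1 / (√(T : ℝ) * √(T : ℝ)) := by rw [← hs]
      rw [h1]
      field_simp
    rw [e]
    exact half_le_self (by positivity)
  · simp only [hEv]
    field_simp
  · have hSE : 0 ≤ ∑ i, Eg i := Finset.sum_nonneg fun i _ => hEg0 i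
    have e : 1 / (T : ℝ) * (α * √(1 + Real.log T) * (∑ i, Eg i)
          / ((1 - β₁) * (1 - γ) * √(1 - β₂)))
        = (1 - β₁) * (α * √(1 + Real.log T) * (∑ i, Eg i)
          / ((1 - β₁) ^ 2 * (1 - γ) * √(1 - β₂) * T)) := by
      field_simp
    rw [e]
    exact mul_le_of_le_one_left (by positivity) (by linarith [hβ₁.1])
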